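/- Let $p\in(0,1]$ and let $v$ be a random variable with $v>0$ almost surely and distribution function $F$. Consider the random directed graph on $\mathbb{Z}$ in which every edge $(i,j)$, $i<j$, is present with probability $p$ and carries a weight $v_{i,j}$ distributed as $v$, all presence indicators and all weights being independent. The weight of an increasing path that uses only present edges is the sum of the weights of its edges. Let $w_{i,j}$ be the maximal weight of such a path from $i$ to $j$ (with $w_{i,j}=-\infty$ if there is none); a path attaining the maximum is called a geodesic. Suppose that the tail of $v$ is regularly varying with index $s>2$, in the sense that $$\frac{1-F(tx)}{1-F(x)}\to t^{-s}\quad\text{as } x\to\infty,\text{ for every } t>0 .$$ (1) Let $\ell_n$ be the length $j-i$ of the longest edge $(i,j)$, and $h_n$ the weight of the heaviest edge, used on the geodesic from $0$ to $n$ (for an arbitrary choice of the geodesic if there are several, and with arbitrary values if there is none). Then, as $n\to\infty$, $$\frac{\log \ell_n}{\log n}\to\frac1{s-1}\quad\text{and}\quad \frac{\log h_n}{\log n}\to\frac1{s-1}\quad\text{in probability.}$$ (2) For every $\beta<1/(s-1)$ and every sequence $(y_n)$ of real numbers, $$\mathbb{P}\big(w_{0,n}\in[y_n,\,y_n+n^\beta]\big)\to0\quad\text{as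 } n\to\infty .$$ (3) If moreover $2<s<3$, then $\operatorname{Var}(w_{0,n})/n\to\infty$, the variances being finite. (If $p<1$, then $w_{0,n}=-\infty$ has positive probability for $n\geq 1$, and the claim holds both for the variance of the positive part $w_{0,n}^+$ and for the variance of $w_{0,n}$ conditionally on $w_{0,n}>-\infty$.) Furthermore no central limit theorem with normalization of order $\sqrt n$ holds, even at a single time: for every $t>0$, every real sequence $(a_n)$ and every $\kappa>0$, $$\frac{w_{0,\lfloor nt\rfloor}-a_n}{\kappa\sqrt n}$$ does not converge in distribution, as $n\to\infty$, to any probability law on $\mathbb{R}$ (in particular, not to a Gaussian law). -/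

import Mathlib

open MeasureTheory ProbabilityTheory Filter Topology

namespace LongRangeLPP

/-- The directed edges `(i, j)` with `i < j` of the complete directed graph on `ℤ`. -/
abbrev Edge : Type := {e : ℤ × ℤ // e.1 < e.2}

/-- The random weighted directed graph on `ℤ`: every edge `(i, j)` with `i < j` is present
(`X (i, j) ω = true`) with probability `p` and carries a weight `v (i, j)` of law `ν`, and all the
presence indicators and all the weights are independent. The values of `X` and `v` at pairs
`(i, j)` with `j ≤ i` play no role. -/
structure IsModel {Ω : Type*} [MeasurableSpace Ω] (μ : Measure Ω) (p : ℝ) (ν : Measure ℝ)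
    (X : ℤ × ℤ → Ω → Bool) (v : ℤ × ℤ → Ω → ℝ) : Prop where
  measurable_present : ∀ e : Edge, Measurable (X e)
  measurable_weight : ∀ e : Edge, Measurable (v e)
  prob_present : ∀ e : Edge, μ {ω | X e ω = true} = ENNReal.ofReal p
  law_weight : ∀ e : Edge, μ.map (v e) = ν
  indep_present_weight : ∀ e : Edge, IndepFun (X e) (v e) μ
  indep_edges : iIndepFun (fun (e : Edge) (ω : Ω) => (X e ω, v e ω)) μ

/-- `IsPath i j π`: the list of edges `π = [(i₀, i₁), (i₁, i₂), …, (iₗ₋₁, iₗ)]` is an increasing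
path, `i = i₀ < i₁ < ⋯ < iₗ = j`, where `l = 0` is allowed. -/
def IsPath : ℤ → ℤ → List (ℤ × ℤ) → Prop
  | i, j, [] => i = j
  | i, j, e :: π => e.1 = i ∧ i < e.2 ∧ IsPath e.2 j π

/-- The sum of the weights `f e` of the edges of a path. -/
def pathWeight (f : ℤ × ℤ → ℝ) (π : List (ℤ × ℤ)) : ℝ := (π.map f).sum

/-- The largest value of `f e` over the edges `e` of a path, for positive `f`
(and `0` for the path without edges). -/
def pathMax (f : ℤ × ℤ → ℝ) : List (ℤ × ℤ) → ℝ
  | [] => 0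
  | e :: π => max (f e) (pathMax f π)

/-- The length `j - i` of the edge `(i, j)`. -/
def edgeLength (e : ℤ × ℤ) : ℝ := ((e.2 - e.1 : ℤ) : ℝ)

/-- The length of the longest edge of a path. -/
def longestEdge (π : List (ℤ × ℤ)) : ℝ := pathMax edgeLength π

section Random

variable {Ω : Type*} (X : ℤ × ℤ → Ω → Bool) (v : ℤ × ℤ → Ω → ℝ)

/-- `π` is a path from `i` to `j` in the random graph: all of its edges are present. -/
def IsOpenPath (i j : ℤ) (ω : Ω) (π : List (ℤ × ℤ)) : Prop :=
  IsPath i j π ∧ ∀ e ∈ π, X e ω = true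

/-- A geodesic: a path of the random graph from `i` to `j` of maximal weight. -/
def IsGeodesic (i j : ℤ) (ω : Ω) (π : List (ℤ × ℤ)) : Prop :=
  IsOpenPath X i j ω π ∧
    ∀ π', IsOpenPath X i j ω π' →
      pathWeight (fun e => v e ω) π' ≤ pathWeight (fun e => v e ω) π

/-- The passage time `w_{i,j}`: the maximal weight of a path of the random graph from `i` to `j`,
and `-∞` if there is no such path. -/
noncomputable def passageTime (i j : ℤ) (ω : Ω) : EReal :=
  ⨆ (π : List (ℤ × ℤ)) (_ : IsOpenPath X i j ω π), ((pathWeight (fun e => v e ω) π : ℝ) : EReal)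

/-- The positive part `w_{i,j}⁺` of the passage time, a real number. -/
noncomputable def passageTimePos (i j : ℤ) (ω : Ω) : ℝ := (max (passageTime X v i j ω) 0).toReal

/-- The weight of the heaviest edge of a path. -/
def heaviestEdge (ω : Ω) (π : List (ℤ × ℤ)) : ℝ := pathMax (fun e => v e ω) π

variable {X v}

theorem IsPath.edge_lt {i j : ℤ} {π : List (ℤ × ℤ)} (h : IsPath i j π) :
    ∀ e ∈ π, e.1 < e.2 := by
  induction π generalizing i with
  | nil => simp
  | cons a π ih =>
    obtain ⟨h1, h2, h3⟩ := h
    intro e he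
    rcases List.mem_cons.1 he with rfl | he
    · omega
    · exact ih h3 e he

/-- The passage time is a random variable. -/
theorem IsModel.measurable_passageTime [MeasurableSpace Ω] {μ : Measure Ω} {p : ℝ}
    {ν : Measure ℝ} (h : IsModel μ p ν X v) (i j : ℤ) : Measurable (passageTime X v i j) := by
  classical
  unfold passageTime
  refine Measurable.iSup fun π => ?_
  by_cases hπ : IsPath i j π
  · have hw : ∀ π' : List (ℤ × ℤ), (∀ e ∈ π', e.1 < e.2) →
        Measurable (fun ω => pathWeight (fun e => v e ω) π') ∧
          MeasurableSet {ω | ∀ e ∈ π', X e ω = true} := by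
      intro π' hlt
      induction π' with
      | nil => simp [pathWeight]
      | cons a π' ih =>
        obtain ⟨ih1, ih2⟩ := ih fun e he => hlt e (List.mem_cons_of_mem _ he)
        have ha : a.1 < a.2 := hlt a List.mem_cons_self
        constructor
        · have hsum := (h.measurable_weight ⟨a, ha⟩).add ih1
          convert hsum using 1
          ext ω
          simp [pathWeight]
        · have := (h.measurable_present ⟨a, ha⟩ (measurableSet_singleton true)).inter ih2
          convert this using 1
          ext ω
          simp
    obtain ⟨h1, h2⟩ := hw π hπ.edge_lt
    have hset : MeasurableSet {ω | IsOpenPath X i j ω π} := by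
      simpa [IsOpenPath, hπ] using h2
    simp_rw [iSup_eq_if]
    exact Measurable.ite hset h1.coe_real_ereal measurable_const
  · simp [IsOpenPath, hπ]

end Random

end LongRangeLPP

/-! Write `α = 1 / (s - 1)`. Replacing an edge of length `l` by a path of many ordinary edges yields
a weight of order `l`, up to factors `n ^ o(1)`, so that an edge is worth using when its weight
exceeds its length. The number of edges of `{0, …, n}` with length and weight of order `l` is about
`n l · l ^ (-s)`, which is of order `1` for `l = n ^ α`. As powers of `n` with arbitrarily small
exponents do not matter, all the estimates are made with such losses.

* Upper bounds. Two points at distance at least `n ^ ε` are joined by two present edges of weight at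
  least `1`, with high probability, and concatenation gives paths of weight almost linear in the
  distance (`WellConnected.exists_path`). Therefore a long edge of a geodesic is heavy
  (`WellConnected.edgeLength_lt`), and Potter's bound with a union bound excludes heavy edges
  beyond the scale `n ^ α` (`IsModel.tendsto_exists_heavy`).
* Lower bounds. The weight of any path is at most the distance of its endpoints plus the *excess*,
  which is the total weight of all the edges around it that are heavier than long
  (`IsPath.pathWeight_le_excess`). By `E v² < ∞` the expected excess is linear in the size of the
  window. At a scale slightly below `n ^ α` there are edges of length `L` with a weight much
  larger than both `L` and the excess around them. A path whose edges are all shorter than `L`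
  would gain by a detour through one of these, so a geodesic has an edge of length at least `L`
  (`WellConnected.exists_long_edge`), and this edge is heavy.
* Anti-concentration. Call champion the heaviest edge among those on geodesics. Conditionally on all
  the other edges, `e` is the champion when its weight lies in some upper set, and there the passage
  time is the weight of `e` plus a constant. The champion is at least `n ^ (α - c)` with high
  probability, and far out a regularly varying tail puts a small proportion of its mass on intervals
  of length `n ^ β` (`HeavyTail.exists_Icc_le`). As the champion is unique, summing over `e` loses
  nothing (`IsModel.measure_passageTime_mem_Icc_le`).
* For `s < 3` one has `α > 1 / 2`. Anti-concentration on a scale `n ^ β` with `β > 1 / 2` makes the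
  variance superlinear, by Chebyshev's inequality, and contradicts a limit law on the scale `√n`. -/

namespace LongRangeLPP

/-! ### Paths -/

lemma IsPath.le {i j : ℤ} {π : List (ℤ × ℤ)} (h : IsPath i j π) : i ≤ j := by
  induction π generalizing i with
  | nil => exact le_of_eq h
  | cons a π ih =>
    obtain ⟨_, h2, h3⟩ := h
    have := ih h3
    omega

lemma IsPath.append {i k j : ℤ} {π₁ π₂ : List (ℤ × ℤ)} (h₁ : IsPath i k π₁)
    (h₂ : IsPath k j π₂) : IsPath i j (π₁ ++ π₂) := by
  induction π₁ generalizing i with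
  | nil => obtain rfl : i = k := h₁; exact h₂
  | cons a π ih => exact ⟨h₁.1, h₁.2.1, ih h₁.2.2⟩

lemma isPath_singleton {e : ℤ × ℤ} (he : e.1 < e.2) : IsPath e.1 e.2 [e] := ⟨rfl, he, rfl⟩

lemma IsPath.bounds {i j : ℤ} {π : List (ℤ × ℤ)} (h : IsPath i j π) :
    ∀ e ∈ π, i ≤ e.1 ∧ e.1 < e.2 ∧ e.2 ≤ j := by
  induction π generalizing i with
  | nil => simp
  | cons a π ih =>
    obtain ⟨h1, h2, h3⟩ := h
    intro e he
    rcases List.mem_cons.1 he with rfl | he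
    · exact ⟨h1.ge, by omega, h3.le⟩
    · have := ih h3 e he
      omega

lemma IsPath.nodup {i j : ℤ} {π : List (ℤ × ℤ)} (h : IsPath i j π) : π.Nodup := by
  induction π generalizing i with
  | nil => simp
  | cons a π ih =>
    obtain ⟨h1, h2, h3⟩ := h
    refine List.nodup_cons.2 ⟨fun ha => ?_, ih h3⟩
    have := h3.bounds a ha
    omega

lemma IsPath.split_edge {i j : ℤ} {π : List (ℤ × ℤ)} (h : IsPath i j π) {e : ℤ × ℤ}
    (he : e ∈ π) : ∃ π₁ π₂, π = π₁ ++ e :: π₂ ∧ IsPath i e.1 π₁ ∧ IsPath e.2 j π₂ := by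
  induction π generalizing i with
  | nil => simp at he
  | cons a π ih =>
    obtain ⟨h1, h2, h3⟩ := h
    rcases List.mem_cons.1 he with rfl | he
    · exact ⟨[], π, rfl, h1.symm, h3⟩
    · obtain ⟨π₁, π₂, rfl, h4, h5⟩ := ih h3 he
      exact ⟨a :: π₁, π₂, rfl, ⟨h1, h2, h4⟩, h5⟩

/-- A path with edges shorter than `L` has a vertex in every window of length `L` between its
endpoints. -/
lemma IsPath.split_window {i j L x₀ : ℤ} {π : List (ℤ × ℤ)} (h : IsPath i j π)
    (hL : ∀ e ∈ π, e.2 - e.1 < L) (hL0 : 0 < L) (hi : i ≤ x₀) (hj : x₀ ≤ j) :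
    ∃ x π₁ π₂, π = π₁ ++ π₂ ∧ IsPath i x π₁ ∧ IsPath x j π₂ ∧ x₀ ≤ x ∧ x < x₀ + L := by
  induction π generalizing i with
  | nil =>
    obtain rfl : i = j := h
    exact ⟨i, [], [], rfl, rfl, rfl, hj, by omega⟩
  | cons a π ih =>
    obtain ⟨h1, h2, h3⟩ := h
    rcases hi.eq_or_lt with rfl | hi
    · exact ⟨i, [], a :: π, rfl, rfl, ⟨h1, h2, h3⟩, le_rfl, by omega⟩
    rcases le_or_gt a.2 x₀ with ha | ha
    · obtain ⟨x, π₁, π₂, rfl, h4, h5, h6⟩ := ih h3 (fun e he => hL e (List.mem_cons_of_mem _ he)) ha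
      exact ⟨x, a :: π₁, π₂, rfl, ⟨h1, h2, h4⟩, h5, h6⟩
    · have := hL a List.mem_cons_self
      exact ⟨a.2, [a], π, rfl, ⟨h1, h2, rfl⟩, h3, ha.le, by omega⟩

lemma pathWeight_append (f : ℤ × ℤ → ℝ) (π₁ π₂ : List (ℤ × ℤ)) :
    pathWeight f (π₁ ++ π₂) = pathWeight f π₁ + pathWeight f π₂ := by
  simp [pathWeight]

lemma pathWeight_cons (f : ℤ × ℤ → ℝ) (e : ℤ × ℤ) (π : List (ℤ × ℤ)) :
    pathWeight f (e :: π) = f e + pathWeight f π := by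
  simp [pathWeight]

lemma le_pathMax {f : ℤ × ℤ → ℝ} {π : List (ℤ × ℤ)} {e : ℤ × ℤ} (he : e ∈ π) :
    f e ≤ pathMax f π := by
  induction π with
  | nil => simp at he
  | cons a π ih =>
    rcases List.mem_cons.1 he with rfl | he
    · exact le_max_left _ _
    · exact (ih he).trans (le_max_right _ _)

lemma pathMax_le {f : ℤ × ℤ → ℝ} {π : List (ℤ × ℤ)} {C : ℝ} (h0 : 0 ≤ C)
    (h : ∀ e ∈ π, f e ≤ C) : pathMax f π ≤ C := by
  induction π with
  | nil => exact h0
  | cons a π ih =>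
    exact max_le (h a List.mem_cons_self) (ih fun e he => h e (List.mem_cons_of_mem _ he))

lemma IsPath.pathWeight_edgeLength {i j : ℤ} {π : List (ℤ × ℤ)} (h : IsPath i j π) :
    pathWeight edgeLength π = ((j - i : ℤ) : ℝ) := by
  induction π generalizing i with
  | nil => obtain rfl : i = j := h; simp [pathWeight]
  | cons a π ih =>
    obtain ⟨h1, h2, h3⟩ := h
    rw [pathWeight_cons, ih h3, edgeLength, h1]
    push_cast
    ring

/-- The edges between two points of `{a, …, b}`. -/
noncomputable def edgesIn (a b : ℤ) : Finset (ℤ × ℤ) :=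
  (Finset.Icc a b ×ˢ Finset.Icc a b).filter fun e => e.1 < e.2

lemma mem_edgesIn {a b : ℤ} {e : ℤ × ℤ} :
    e ∈ edgesIn a b ↔ a ≤ e.1 ∧ e.1 < e.2 ∧ e.2 ≤ b := by
  simp only [edgesIn, Finset.mem_filter, Finset.mem_product, Finset.mem_Icc]
  omega

/-- An edge weight counted only if it exceeds the length of the edge. -/
noncomputable def excess (f : ℤ × ℤ → ℝ) (e : ℤ × ℤ) : ℝ := if edgeLength e < f e then f e else 0

lemma excess_nonneg (f : ℤ × ℤ → ℝ) {e : ℤ × ℤ} (he : e.1 < e.2) : 0 ≤ excess f e := by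
  unfold excess
  split_ifs with h
  · have : (0 : ℝ) ≤ edgeLength e := by
      unfold edgeLength
      exact_mod_cast (by omega : (0 : ℤ) ≤ e.2 - e.1)
    linarith
  · exact le_rfl

lemma le_edgeLength_add_excess (f : ℤ × ℤ → ℝ) {e : ℤ × ℤ} (he : e.1 < e.2) :
    f e ≤ edgeLength e + excess f e := by
  have : (0 : ℝ) ≤ edgeLength e := by
    unfold edgeLength
    exact_mod_cast (by omega : (0 : ℤ) ≤ e.2 - e.1)
  unfold excess
  split_ifs with h <;> linarith

lemma pathWeight_eq_sum (f : ℤ × ℤ → ℝ) {i j : ℤ} {π : List (ℤ × ℤ)} (h : IsPath i j π) :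
    pathWeight f π = ∑ e ∈ π.toFinset, f e := by
  rw [pathWeight, List.sum_toFinset _ h.nodup]

/-- The lengths along a path telescope, so that its weight is at most the distance of its endpoints
plus the total weight of *all* the edges around it whose weight exceeds their length. -/
lemma IsPath.pathWeight_le_excess {i j : ℤ} {π : List (ℤ × ℤ)} (h : IsPath i j π)
    (f : ℤ × ℤ → ℝ) {E : Finset (ℤ × ℤ)} (hE : ∀ e ∈ E, e.1 < e.2) (hπ : ∀ e ∈ π, e ∈ E) :
    pathWeight f π ≤ ((j - i : ℤ) : ℝ) + ∑ e ∈ E, excess f e := by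
  rw [← h.pathWeight_edgeLength, pathWeight_eq_sum f h, pathWeight_eq_sum _ h]
  have h1 : ∑ e ∈ π.toFinset, excess f e ≤ ∑ e ∈ E, excess f e :=
    Finset.sum_le_sum_of_subset_of_nonneg (fun e he => hπ e (List.mem_toFinset.1 he))
      fun e he _ => excess_nonneg f (hE e he)
  have h2 : ∑ e ∈ π.toFinset, f e ≤ ∑ e ∈ π.toFinset, (edgeLength e + excess f e) :=
    Finset.sum_le_sum fun e he => le_edgeLength_add_excess f (h.edge_lt e (List.mem_toFinset.1 he))
  rw [Finset.sum_add_distrib] at h2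
  linarith

lemma IsPath.abs_pathWeight_le {i j : ℤ} {π : List (ℤ × ℤ)} (h : IsPath i j π) (f : ℤ × ℤ → ℝ) :
    |pathWeight f π| ≤ ∑ e ∈ edgesIn i j, |f e| := by
  rw [pathWeight_eq_sum f h]
  refine (Finset.abs_sum_le_sum_abs _ _).trans ?_
  exact Finset.sum_le_sum_of_subset_of_nonneg
    (fun e he => mem_edgesIn.2 (h.bounds e (List.mem_toFinset.1 he))) fun e _ _ => abs_nonneg _

lemma finite_isPath (i j : ℤ) : {π | IsPath i j π}.Finite := by
  obtain ⟨m, hm⟩ : ∃ m : ℕ, j - i ≤ m := ⟨(j - i).toNat, Int.self_le_toNat _⟩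
  induction m generalizing i with
  | zero =>
    refine (Set.finite_singleton []).subset fun π hπ => ?_
    cases π with
    | nil => rfl
    | cons a π =>
      have := IsPath.bounds hπ a List.mem_cons_self
      push_cast at hm
      omega
  | succ m ih =>
    refine ((Set.finite_singleton []).union
      ((Set.finite_Ioc i j).biUnion
        (t := fun k => List.cons (i, k) '' {π | i < k ∧ IsPath k j π}) fun k hk => ?_)).subset ?_
    · refine Set.Finite.image _ ((ih k ?_).subset fun π hπ => hπ.2)
      push_cast at hm
      have := hk.1
      omega
    · intro π hπ
      cases π with
      | nil => exact Or.inl rfl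
      | cons a π =>
        obtain ⟨h1, h2, h3⟩ := hπ
        refine Or.inr (Set.mem_biUnion (x := a.2) ⟨h2, h3.le⟩ ⟨π, ⟨h2, h3⟩, ?_⟩)
        rw [← h1]

section Geodesics

variable {Ω : Type*} {X : ℤ × ℤ → Ω → Bool} {v : ℤ × ℤ → Ω → ℝ} {ω : Ω}

lemma IsOpenPath.append {i k j : ℤ} {π₁ π₂ : List (ℤ × ℤ)} (h₁ : IsOpenPath X i k ω π₁)
    (h₂ : IsOpenPath X k j ω π₂) : IsOpenPath X i j ω (π₁ ++ π₂) :=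
  ⟨h₁.1.append h₂.1, fun e he => (List.mem_append.1 he).elim (h₁.2 e) (h₂.2 e)⟩

lemma isOpenPath_singleton {e : ℤ × ℤ} (he : e.1 < e.2) (hX : X e ω = true) :
    IsOpenPath X e.1 e.2 ω [e] :=
  ⟨isPath_singleton he, by simpa using hX⟩

lemma exists_isGeodesic {i j : ℤ} (h : ∃ π, IsOpenPath X i j ω π) :
    ∃ π, IsGeodesic X v i j ω π := by
  have hfin : {π | IsOpenPath X i j ω π}.Finite := (finite_isPath i j).subset fun π hπ => hπ.1
  obtain ⟨π, hπ, hmax⟩ := hfin.exists_maximalFor (pathWeight fun e => v e ω) _ h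
  refine ⟨π, hπ, fun π' hπ' => ?_⟩
  by_contra hlt
  exact hlt (hmax hπ' (not_le.1 hlt).le)

lemma IsGeodesic.passageTime_eq {i j : ℤ} {π : List (ℤ × ℤ)} (h : IsGeodesic X v i j ω π) :
    passageTime X v i j ω = ((pathWeight (fun e => v e ω) π : ℝ) : EReal) := by
  refine le_antisymm (iSup₂_le fun π' hπ' => EReal.coe_le_coe (h.2 π' hπ')) ?_
  exact le_iSup₂ (f := fun π (_ : IsOpenPath X i j ω π) =>
    ((pathWeight (fun e => v e ω) π : ℝ) : EReal)) π h.1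

lemma passageTime_eq_bot {i j : ℤ} (h : ¬ ∃ π, IsOpenPath X i j ω π) :
    passageTime X v i j ω = ⊥ := by
  push Not at h
  simp [passageTime, h]

lemma abs_toReal_passageTime_le (i j : ℤ) :
    |(passageTime X v i j ω).toReal| ≤ ∑ e ∈ edgesIn i j, |v e ω| := by
  by_cases h : ∃ π, IsOpenPath X i j ω π
  · obtain ⟨π, hπ⟩ := exists_isGeodesic (v := v) h
    rw [hπ.passageTime_eq, EReal.toReal_coe]
    exact hπ.1.1.abs_pathWeight_le _
  · rw [passageTime_eq_bot h]
    simpa using Finset.sum_nonneg fun e _ => abs_nonneg _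

lemma passageTimePos_eq (i j : ℤ) :
    passageTimePos X v i j ω = max (passageTime X v i j ω).toReal 0 := by
  by_cases h : ∃ π, IsOpenPath X i j ω π
  · obtain ⟨π, hπ⟩ := exists_isGeodesic (v := v) h
    rw [passageTimePos, hπ.passageTime_eq, EReal.toReal_coe, ← EReal.coe_zero,
      ← EReal.coe_strictMono.monotone.map_max,
      EReal.toReal_coe]
  · rw [passageTimePos, passageTime_eq_bot h]
    simp

/-- All points of `{0, …, N}` at distance at least `d` are joined by two present edges of
weight at least `1`. -/
def WellConnected (X : ℤ × ℤ → Ω → Bool) (v : ℤ × ℤ → Ω → ℝ) (N d : ℤ) (ω : Ω) : Prop :=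
  ∀ i j : ℤ, 0 ≤ i → j ≤ N → i + d ≤ j → ∃ k, i < k ∧ k < j ∧
    (X (i, k) ω = true ∧ 1 ≤ v (i, k) ω) ∧ (X (k, j) ω = true ∧ 1 ≤ v (k, j) ω)

/-- Concatenating two-edge connections gives paths of weight linear in the distance. -/
lemma WellConnected.exists_path {N d : ℤ} (hd : 0 < d) (h : WellConnected X v N d ω) {i j : ℤ}
    (hi : 0 ≤ i) (hj : j ≤ N) (hij : i + d ≤ j) :
    ∃ π, IsOpenPath X i j ω π ∧ ((j - i : ℤ) : ℝ) < d * pathWeight (fun e => v e ω) π := by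
  have hd' : (0 : ℝ) < d := by exact_mod_cast hd
  have two : ∀ i j : ℤ, 0 ≤ i → j ≤ N → i + d ≤ j →
      ∃ π, IsOpenPath X i j ω π ∧ 2 ≤ pathWeight (fun e => v e ω) π := by
    intro i j hi hj hij
    obtain ⟨k, h1, h2, ⟨h3, h4⟩, h5, h6⟩ := h i j hi hj hij
    refine ⟨[(i, k)] ++ [(k, j)],
      (isOpenPath_singleton (e := (i, k)) h1 h3).append (isOpenPath_singleton (e := (k, j)) h2 h5),
      ?_⟩
    simp only [pathWeight, List.cons_append, List.nil_append, List.map_cons, List.map_nil,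
      List.sum_cons, List.sum_nil]
    linarith
  obtain ⟨m, hm⟩ : ∃ m : ℕ, j - i ≤ m := ⟨(j - i).toNat, Int.self_le_toNat _⟩
  induction m generalizing i with
  | zero => push_cast at hm; omega
  | succ m ih =>
    rcases lt_or_ge j (i + 2 * d) with hlt | hge
    · obtain ⟨π, hπ, hw⟩ := two i j hi hj hij
      refine ⟨π, hπ, ?_⟩
      have : ((j - i : ℤ) : ℝ) < ((2 * d : ℤ) : ℝ) := by exact_mod_cast (by omega)
      push_cast at this ⊢
      nlinarith
    · obtain ⟨π₁, hπ₁, hw₁⟩ := two i (i + d) hi (by omega) le_rfl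
      push_cast at hm
      obtain ⟨π₂, hπ₂, hw₂⟩ := ih (i := i + d) (by omega) (by omega) (by omega)
      refine ⟨π₁ ++ π₂, hπ₁.append hπ₂, ?_⟩
      rw [pathWeight_append]
      push_cast at hw₂ ⊢
      nlinarith

lemma WellConnected.exists_path_pos {N d : ℤ} (hd : 0 < d) (h : WellConnected X v N d ω) {i j : ℤ}
    (hi : 0 ≤ i) (hj : j ≤ N) (hij : i + d ≤ j) :
    ∃ π, IsOpenPath X i j ω π ∧ 0 < pathWeight (fun e => v e ω) π := by
  obtain ⟨π, hπ, hw⟩ := h.exists_path hd hi hj hij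
  refine ⟨π, hπ, ?_⟩
  have h1 : (0 : ℝ) < ((j - i : ℤ) : ℝ) := by exact_mod_cast (by omega)
  have hd' : (0 : ℝ) < d := by exact_mod_cast hd
  exact pos_of_mul_pos_right (h1.trans hw) hd'.le

/-- A long edge of a geodesic is heavy, since it could be replaced by a path of linear weight. -/
lemma WellConnected.edgeLength_lt {N d : ℤ} (hd : 0 < d) (h : WellConnected X v N d ω)
    {π : List (ℤ × ℤ)} (hπ : IsGeodesic X v 0 N ω π) {e : ℤ × ℤ} (he : e ∈ π)
    (hde : d ≤ e.2 - e.1) : edgeLength e < d * v e ω := by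
  have hb := hπ.1.1.bounds e he
  obtain ⟨ρ, hρ, hw⟩ := h.exists_path hd hb.1 hb.2.2 (by omega)
  obtain ⟨π₁, π₂, rfl, h1, h2⟩ := hπ.1.1.split_edge he
  have hopen := hπ.1.2
  have hnew : IsOpenPath X 0 N ω (π₁ ++ (ρ ++ π₂)) := by
    refine IsOpenPath.append ⟨h1, fun e' he' => hopen e' (by simp [he'])⟩
      (hρ.append ⟨h2, fun e' he' => hopen e' (by simp [he'])⟩)
  have hle := hπ.2 _ hnew
  simp only [pathWeight_append, pathWeight_cons] at hle
  have hd' : (0 : ℝ) < d := by exact_mod_cast hd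
  have : (d : ℝ) * pathWeight (fun e => v e ω) ρ ≤ d * v e ω :=
    mul_le_mul_of_nonneg_left (by linarith) hd'.le
  exact lt_of_lt_of_le hw this

/-- If some present edge `e` of length in `[L, 2L]` outweighs everything that paths around it can
collect without it, then a geodesic has an edge of length at least `L`: a path with
shorter edges only could be rerouted through `e`. -/
lemma WellConnected.exists_long_edge {N d L : ℤ} (hd : 0 < d) (hdL : d ≤ L)
    (h : WellConnected X v N d ω) {π : List (ℤ × ℤ)} (hπ : IsGeodesic X v 0 N ω π)
    {e : ℤ × ℤ} (he0 : 2 * L ≤ e.1) (heN : e.2 + 2 * L ≤ N) (heL : L ≤ e.2 - e.1)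
    (heL' : e.2 - e.1 ≤ 2 * L) (hX : X e ω = true)
    (hS : 6 * L + ∑ e' ∈ (edgesIn (e.1 - 2 * L) (e.2 + 2 * L)).erase e, excess (fun e => v e ω) e'
      ≤ v e ω) :
    ∃ e' ∈ π, L ≤ e'.2 - e'.1 := by
  by_contra hcon
  push Not at hcon
  obtain ⟨x, π₁, π', rfl, h1, h', hx1, hx2⟩ :=
    hπ.1.1.split_window (x₀ := e.1 - 2 * L) hcon (by omega) (by omega) (by omega)
  obtain ⟨y, π₂, π₃, rfl, h2, h3, hy1, hy2⟩ :=
    h'.split_window (x₀ := e.2 + L) (fun e he => hcon e (by simp [he])) (by omega) (by omega)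
      (by omega)
  have hopen := hπ.1.2
  obtain ⟨ρ₁, hρ₁, hw₁⟩ := h.exists_path_pos (i := x) (j := e.1) hd (by omega) (by omega) (by omega)
  obtain ⟨ρ₂, hρ₂, hw₂⟩ := h.exists_path_pos (i := e.2) (j := y) hd (by omega) (by omega) (by omega)
  have hnew : IsOpenPath X 0 N ω (π₁ ++ ((ρ₁ ++ ([e] ++ ρ₂)) ++ π₃)) := by
    refine IsOpenPath.append ⟨h1, fun e' he' => hopen e' (by simp [he'])⟩
      (IsOpenPath.append (hρ₁.append ((isOpenPath_singleton (by omega) hX).append hρ₂))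
        ⟨h3, fun e' he' => hopen e' (by simp [he'])⟩)
  have hle := hπ.2 _ hnew
  have hseg := h2.pathWeight_le_excess (fun e => v e ω)
    (E := (edgesIn (e.1 - 2 * L) (e.2 + 2 * L)).erase e)
    (fun e' he' => (mem_edgesIn.1 (Finset.mem_of_mem_erase he')).2.1) (fun e' he' => by
      have hb := h2.bounds e' he'
      refine Finset.mem_erase.2 ⟨?_, mem_edgesIn.2 (by omega)⟩
      rintro rfl
      have := hcon e' (by simp [he'])
      omega)
  have hyx : ((y - x : ℤ) : ℝ) ≤ ((6 * L : ℤ) : ℝ) := by exact_mod_cast (by omega)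
  push_cast at hyx hseg
  simp only [pathWeight_append, pathWeight_cons] at hle
  have h0 : pathWeight (fun e => v e ω) [] = 0 := rfl
  linarith

end Geodesics

/-! ### Independence of the edges -/

section Independence

variable {Ω : Type*}

variable {p : ℝ} {ν : Measure ℝ} {X : ℤ × ℤ → Ω → Bool} {v : ℤ × ℤ → Ω → ℝ}

/-- The presence indicator and the weight of `e`, set to `(false, 0)` where `e` is not an edge:
there `X` and `v` are arbitrary, and possibly not measurable. -/
noncomputable def edgeData (X : ℤ × ℤ → Ω → Bool) (v : ℤ × ℤ → Ω → ℝ) (e : ℤ × ℤ) (ω : Ω) :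
    Bool × ℝ :=
  if e.1 < e.2 then (X e ω, v e ω) else (false, 0)

lemma edgeData_of_lt {e : ℤ × ℤ} (he : e.1 < e.2) : edgeData X v e = fun ω => (X e ω, v e ω) := by
  ext ω <;> simp [edgeData, he]

/-- The edge `e` is present and its weight is at least `x`. -/
def PresentGe (X : ℤ × ℤ → Ω → Bool) (v : ℤ × ℤ → Ω → ℝ) (x : ℝ) (e : ℤ × ℤ) (ω : Ω) : Prop :=
  X e ω = true ∧ x ≤ v e ω

lemma measurableSet_presentGe_comap {e : ℤ × ℤ} (he : e.1 < e.2) (x : ℝ) :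
    MeasurableSet[MeasurableSpace.comap (edgeData X v e) inferInstance]
      {ω | PresentGe X v x e ω} := by
  refine ⟨{true} ×ˢ Set.Ici x, (measurableSet_singleton _).prod measurableSet_Ici, ?_⟩
  ext ω
  simp [edgeData, he, PresentGe]

variable [MeasurableSpace Ω] {μ : Measure Ω}

lemma iIndepFun_extend_const {ι β : Type*} [MeasurableSpace β] [IsProbabilityMeasure μ]
    {q : ι → Prop} [DecidablePred q] {f : ι → Ω → β}
    (hf : iIndepFun (fun (i : {i // q i}) => f i) μ) (c : β) :
    iIndepFun (fun i ω => if q i then f i ω else c) μ := by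
  classical
  rw [iIndepFun_iff_measure_inter_preimage_eq_mul] at hf ⊢
  intro S A hA
  by_cases hc : ∃ i ∈ S, ¬ q i ∧ c ∉ A i
  · obtain ⟨i, hiS, hi, hci⟩ := hc
    have h0 : (fun ω => if q i then f i ω else c) ⁻¹' A i = ∅ := by
      ext ω; simp [hi, hci]
    rw [Finset.prod_eq_zero hiS (by rw [h0, measure_empty])]
    exact measure_mono_null (Set.biInter_subset_of_mem hiS) (by rw [h0, measure_empty])
  · push Not at hc
    have hset : (⋂ i ∈ S, (fun ω => if q i then f i ω else c) ⁻¹' A i) =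
        ⋂ i ∈ S.subtype q, f i ⁻¹' A i := by
      ext ω
      simp only [Set.mem_iInter, Set.mem_preimage, Finset.mem_subtype, Subtype.forall]
      refine ⟨fun h i hi hiS => by simpa [hi] using h i hiS, fun h i hiS => ?_⟩
      by_cases hi : q i
      · simpa [hi] using h i hi hiS
      · simpa [hi] using hc i hiS hi
    rw [hset, hf (S.subtype q) (sets := fun i => A i)
      (fun i hi => hA i (Finset.mem_subtype.1 hi)), Finset.prod_subtype_eq_prod_filter
        (f := fun i => μ (f i ⁻¹' A i)), Finset.prod_filter]
    refine Finset.prod_congr rfl fun i hiS => ?_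
    by_cases hi : q i
    · simp [hi]
    · have : (fun ω => if q i then f i ω else c) ⁻¹' A i = Set.univ := by
        ext ω; simpa [hi] using hc i hiS hi
      rw [this]
      simp [hi]

lemma IsModel.measurable_edgeData (h : IsModel μ p ν X v) (e : ℤ × ℤ) :
    Measurable (edgeData X v e) := by
  by_cases he : e.1 < e.2
  · rw [edgeData_of_lt he]
    exact (h.measurable_present ⟨e, he⟩).prodMk (h.measurable_weight ⟨e, he⟩)
  · have : edgeData X v e = fun _ => (false, 0) := by ext ω <;> simp [edgeData, he]
    rw [this]
    exact measurable_const

lemma IsModel.iIndepFun_edgeData [IsProbabilityMeasure μ] (h : IsModel μ p ν X v) :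
    iIndepFun (edgeData X v) μ := by
  classical
  exact iIndepFun_extend_const (q := fun e : ℤ × ℤ => e.1 < e.2)
    (f := fun e ω => (X e ω, v e ω)) h.indep_edges (false, 0)

lemma IsModel.map_edgeData [IsProbabilityMeasure μ] (h : IsModel μ p ν X v) {e : ℤ × ℤ}
    (he : e.1 < e.2) : μ.map (edgeData X v e) = (μ.map (X e)).prod ν := by
  rw [edgeData_of_lt he, ← h.law_weight ⟨e, he⟩]
  exact (h.indep_present_weight ⟨e, he⟩).map_prod_eq_prod_map_map
    (h.measurable_present ⟨e, he⟩).aemeasurable (h.measurable_weight ⟨e, he⟩).aemeasurable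

lemma IsModel.measure_weight (h : IsModel μ p ν X v) {e : ℤ × ℤ}
    (he : e.1 < e.2) {s : Set ℝ} (hs : MeasurableSet s) : μ (v e ⁻¹' s) = ν s := by
  rw [← h.law_weight ⟨e, he⟩, Measure.map_apply (h.measurable_weight ⟨e, he⟩) hs]

lemma IsModel.measure_presentGe (h : IsModel μ p ν X v) {e : ℤ × ℤ} (he : e.1 < e.2) (x : ℝ) :
    μ {ω | PresentGe X v x e ω} = ENNReal.ofReal p * ν (Set.Ici x) := by
  have := (h.indep_present_weight ⟨e, he⟩).measure_inter_preimage_eq_mul {true} (Set.Ici x)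
    (measurableSet_singleton true) measurableSet_Ici
  rw [h.measure_weight he measurableSet_Ici] at this
  rw [← h.prob_present ⟨e, he⟩]
  exact this

lemma IsModel.measurableSet_presentGe (h : IsModel μ p ν X v) {e : ℤ × ℤ} (he : e.1 < e.2)
    (x : ℝ) : MeasurableSet {ω | PresentGe X v x e ω} :=
  (h.measurable_edgeData e).comap_le _ (measurableSet_presentGe_comap he x)

lemma prob_compl_real [IsProbabilityMeasure μ] {A : Set Ω} (hA : MeasurableSet A) {a : ℝ}
    (ha : μ A = ENNReal.ofReal a) (ha0 : 0 ≤ a) : μ Aᶜ = ENNReal.ofReal (1 - a) := by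
  rw [prob_compl_eq_one_sub hA, ha, ENNReal.ofReal_sub _ ha0, ENNReal.ofReal_one]

lemma IsModel.measure_presentGe' [IsFiniteMeasure ν] (h : IsModel μ p ν X v) (hp : 0 ≤ p)
    {e : ℤ × ℤ} (he : e.1 < e.2) (x : ℝ) :
    μ {ω | PresentGe X v x e ω} = ENNReal.ofReal (p * ν.real (Set.Ici x)) := by
  rw [h.measure_presentGe he, ENNReal.ofReal_mul hp, ofReal_measureReal]

/-- The probability that none of the edges of `F` is present and heavy. -/
lemma IsModel.measure_forall_not_presentGe [IsProbabilityMeasure μ] [IsFiniteMeasure ν]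
    (h : IsModel μ p ν X v) (hp : 0 ≤ p) (x : ℝ) (F : Finset (ℤ × ℤ)) (hF : ∀ e ∈ F, e.1 < e.2) :
    μ {ω | ∀ e ∈ F, ¬ PresentGe X v x e ω} =
      ENNReal.ofReal (1 - p * ν.real (Set.Ici x)) ^ F.card := by
  have h1 := h.iIndepFun_edgeData.meas_biInter (S := F)
    (s := fun e => {ω | PresentGe X v x e ω}ᶜ)
    (fun e he => (measurableSet_presentGe_comap (hF e he) x).compl)
  have h2 : {ω | ∀ e ∈ F, ¬ PresentGe X v x e ω} = ⋂ e ∈ F, {ω | PresentGe X v x e ω}ᶜ := by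
    ext ω; simp
  rw [h2, h1, ← Finset.prod_const]
  refine Finset.prod_congr rfl fun e he => ?_
  exact prob_compl_real (h.measurableSet_presentGe (hF e he) x)
    (h.measure_presentGe' hp (hF e he) x) (mul_nonneg hp measureReal_nonneg)

/-- The probability that no `k ∈ K` joins `i` to `j` by two present heavy edges: the pairs of edges
are disjoint for distinct `k`. -/
lemma IsModel.measure_forall_not_joined [IsProbabilityMeasure μ] [IsFiniteMeasure ν]
    (h : IsModel μ p ν X v) (hp : 0 ≤ p) (x : ℝ) {i j : ℤ} (K : Finset ℤ)
    (hK : ∀ k ∈ K, i < k ∧ k < j) :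
    μ {ω | ∀ k ∈ K, ¬ (PresentGe X v x (i, k) ω ∧ PresentGe X v x (k, j) ω)} =
      ENNReal.ofReal (1 - (p * ν.real (Set.Ici x)) ^ 2) ^ K.card := by
  classical
  set m : ℤ × ℤ → MeasurableSpace Ω := fun e => MeasurableSpace.comap (edgeData X v e) inferInstance
    with hm
  have hle : ∀ e, m e ≤ ‹MeasurableSpace Ω› := fun e => (h.measurable_edgeData e).comap_le
  have hpair : ∀ (S : Set (ℤ × ℤ)) (k : ℤ), i < k → k < j → (i, k) ∈ S → (k, j) ∈ S →
      MeasurableSet[⨆ e ∈ S, m e] {ω | PresentGe X v x (i, k) ω ∧ PresentGe X v x (k, j) ω} := by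
    intro S k h1 h2 h3 h4
    refine @MeasurableSet.inter _ (⨆ e ∈ S, m e) _ _ ?_ ?_
    · exact le_iSup₂ (f := fun e (_ : e ∈ S) => m e) _ h3 _
        (measurableSet_presentGe_comap (X := X) (v := v) (e := (i, k)) h1 x)
    · exact le_iSup₂ (f := fun e (_ : e ∈ S) => m e) _ h4 _
        (measurableSet_presentGe_comap (X := X) (v := v) (e := (k, j)) h2 x)
  induction K using Finset.induction_on with
  | empty => simp
  | insert k K hk ih =>
    have hK' : ∀ k ∈ K, i < k ∧ k < j := fun k' hk' => hK k' (Finset.mem_insert_of_mem hk')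
    obtain ⟨hik, hkj⟩ := hK k (Finset.mem_insert_self _ _)
    have hset : {ω | ∀ k' ∈ insert k K,
        ¬ (PresentGe X v x (i, k') ω ∧ PresentGe X v x (k', j) ω)} =
        {ω | PresentGe X v x (i, k) ω ∧ PresentGe X v x (k, j) ω}ᶜ ∩
        {ω | ∀ k' ∈ K, ¬ (PresentGe X v x (i, k') ω ∧ PresentGe X v x (k', j) ω)} := by
      ext ω; simp
    set S : Set (ℤ × ℤ) := {(i, k), (k, j)} with hS
    set T : Set (ℤ × ℤ) := {e | ∃ k' ∈ K, e = (i, k') ∨ e = (k', j)} with hT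
    have hST : Disjoint S T := by
      rw [Set.disjoint_left]
      rintro e he ⟨k', hk', he'⟩
      obtain ⟨h1, h2⟩ := hK' k' hk'
      have hne : k ≠ k' := by rintro rfl; exact hk hk'
      simp only [hS, Set.mem_insert_iff, Set.mem_singleton_iff] at he
      rcases he with rfl | rfl <;> rcases he' with he' | he' <;>
        · rw [Prod.mk.injEq] at he'
          omega
    have hind := indep_iSup_of_disjoint hle h.iIndepFun_edgeData.iIndep hST
    have hT' : MeasurableSet[⨆ e ∈ T, m e]
        {ω | ∀ k' ∈ K, ¬ (PresentGe X v x (i, k') ω ∧ PresentGe X v x (k', j) ω)} := by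
      have : {ω | ∀ k' ∈ K, ¬ (PresentGe X v x (i, k') ω ∧ PresentGe X v x (k', j) ω)} =
          ⋂ k' ∈ K, {ω | PresentGe X v x (i, k') ω ∧ PresentGe X v x (k', j) ω}ᶜ := by
        ext ω; simp
      rw [this]
      refine Finset.measurableSet_biInter _ fun k' hk' => ?_
      exact (hpair T k' (hK' k' hk').1 (hK' k' hk').2 ⟨k', hk', Or.inl rfl⟩
        ⟨k', hk', Or.inr rfl⟩).compl
    rw [hset, (Indep_iff _ _ _).1 hind _ _
      (hpair S k hik hkj (by simp [hS]) (by simp [hS])).compl hT', ih hK',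
      Finset.card_insert_of_notMem hk, pow_succ' _ K.card]
    congr 1
    have hA := h.measurableSet_presentGe (e := (i, k)) hik x
    have hB := h.measurableSet_presentGe (e := (k, j)) hkj x
    refine prob_compl_real (μ := μ) (hA.inter hB) ?_ (sq_nonneg _)
    have hne : ((i, k) : ℤ × ℤ) ≠ (k, j) := by
      intro he
      rw [Prod.mk.injEq] at he
      omega
    have hind' := h.iIndepFun_edgeData.iIndep.indep hne
    have hAB := (Indep_iff _ _ _).1 hind' _ _
      (measurableSet_presentGe_comap (X := X) (v := v) (e := (i, k)) hik x)
      (measurableSet_presentGe_comap (X := X) (v := v) (e := (k, j)) hkj x)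
    rw [h.measure_presentGe' hp hik, h.measure_presentGe' hp hkj] at hAB
    rw [sq, ENNReal.ofReal_mul (mul_nonneg hp measureReal_nonneg)]
    exact hAB

lemma IsModel.measure_not_wellConnected_le [IsProbabilityMeasure μ] [IsProbabilityMeasure ν]
    (h : IsModel μ p ν X v) (hp : 0 ≤ p) (N d : ℕ) :
    μ {ω | ¬ WellConnected X v N d ω} ≤
      ((N + 1 : ℕ) : ENNReal) ^ 2 *
        ENNReal.ofReal (1 - (p * ν.real (Set.Ici 1)) ^ 2) ^ (d - 1) := by
  classical
  set c := ENNReal.ofReal (1 - (p * ν.real (Set.Ici 1)) ^ 2) with hc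
  have hc1 : c ≤ 1 := by
    rw [hc, ← ENNReal.ofReal_one]
    exact ENNReal.ofReal_le_ofReal (by nlinarith [sq_nonneg (p * ν.real (Set.Ici 1))])
  set P : Finset (ℤ × ℤ) :=
    (Finset.Icc (0 : ℤ) N ×ˢ Finset.Icc (0 : ℤ) N).filter fun e => e.1 + d ≤ e.2 with hP
  have hsub : {ω | ¬ WellConnected X v N d ω} ⊆ ⋃ e ∈ P, {ω | ∀ k ∈ Finset.Ioo e.1 e.2,
      ¬ (PresentGe X v 1 (e.1, k) ω ∧ PresentGe X v 1 (k, e.2) ω)} := by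
    intro ω hω
    simp only [WellConnected, Set.mem_ofPred_eq, not_forall] at hω
    obtain ⟨i, j, hi, hj, hij, hno⟩ := hω
    push Not at hno
    simp only [Set.mem_iUnion]
    refine ⟨(i, j), ?_, fun k hk hcon => ?_⟩
    · simp only [hP, Finset.mem_filter, Finset.mem_product, Finset.mem_Icc]
      omega
    · rw [Finset.mem_Ioo] at hk
      exact hno k hk.1 hk.2 hcon.1 hcon.2.1 |>.not_ge hcon.2.2
  refine (measure_mono hsub).trans ((measure_biUnion_finset_le _ _).trans ?_)
  calc _ ≤ ∑ e ∈ P, c ^ (d - 1) := by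
        refine Finset.sum_le_sum fun e he => ?_
        rw [h.measure_forall_not_joined hp 1 _ fun k hk => Finset.mem_Ioo.1 hk, ← hc,
          Int.card_Ioo]
        simp only [hP, Finset.mem_filter] at he
        exact pow_le_pow_right_of_le_one' hc1 (by omega)
    _ ≤ _ := by
        rw [Finset.sum_const, nsmul_eq_mul]
        gcongr
        have : P.card ≤ (N + 1) ^ 2 := by
          refine (Finset.card_filter_le _ _).trans ?_
          rw [Finset.card_product, Int.card_Icc, sq]
          simp
        exact_mod_cast this

/-- A union bound over the edges of `{0, …, N}`. -/
lemma IsModel.measure_exists_weight_ge_le (h : IsModel μ p ν X v) (N : ℤ) (g : ℤ × ℤ → ℝ) :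
    μ {ω | ∃ e ∈ edgesIn 0 N, g e ≤ v e ω} ≤ ∑ e ∈ edgesIn 0 N, ν (Set.Ici (g e)) := by
  have : {ω | ∃ e ∈ edgesIn 0 N, g e ≤ v e ω} = ⋃ e ∈ edgesIn 0 N, v e ⁻¹' Set.Ici (g e) := by
    ext ω; simp
  rw [this]
  refine (measure_biUnion_finset_le _ _).trans (Finset.sum_le_sum fun e he => ?_)
  rw [h.measure_weight (mem_edgesIn.1 he).2.1 measurableSet_Ici]

/-- A sum over the edges of a window, bounded by a sum over their left endpoints and lengths. -/
lemma sum_edgesIn_le (G : ℤ → ENNReal) (a : ℤ) (m : ℕ) :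
    ∑ e ∈ edgesIn a (a + m), G (e.2 - e.1) ≤
      ((m + 1 : ℕ) : ENNReal) * ∑ l ∈ Finset.Icc 1 m, G (l : ℤ) := by
  have hinj : Function.Injective fun q : ℤ × ℕ => (q.1, q.1 + (q.2 : ℤ)) := by
    rintro ⟨i, l⟩ ⟨i', l'⟩ h
    simp only [Prod.mk.injEq] at h ⊢
    omega
  calc ∑ e ∈ edgesIn a (a + m), G (e.2 - e.1)
      ≤ ∑ q ∈ (Finset.Icc a (a + m) ×ˢ Finset.Icc 1 m).map ⟨_, hinj⟩, G (q.2 - q.1) := by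
        refine Finset.sum_le_sum_of_subset fun e he => ?_
        have := mem_edgesIn.1 he
        refine Finset.mem_map.2 ⟨(e.1, (e.2 - e.1).toNat), ?_, ?_⟩
        · rw [Finset.mem_product, Finset.mem_Icc, Finset.mem_Icc]
          dsimp only
          omega
        · refine Prod.ext rfl ?_
          simp only [Function.Embedding.coeFn_mk]
          omega
    _ = ∑ i ∈ Finset.Icc a (a + m), ∑ l ∈ Finset.Icc 1 m, G (l : ℤ) := by
        rw [Finset.sum_map, Finset.sum_product]
        simp
    _ = _ := by
        rw [Finset.sum_const, Int.card_Icc, nsmul_eq_mul]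
        congr 2
        omega

/-- The sum over the lengths `l ≥ 1` of `x 1{x > l}` is at most `x²`. -/
lemma sum_ite_lt_le (x : ℝ) (m : ℕ) :
    ∑ l ∈ Finset.Icc 1 m, (if (l : ℝ) < x then x else 0) ≤ x ^ 2 := by
  rw [← Finset.sum_filter, Finset.sum_const, nsmul_eq_mul]
  rcases le_or_gt x 0 with hx | hx
  · have : (Finset.Icc 1 m).filter (fun l : ℕ => (l : ℝ) < x) = ∅ := by
      refine Finset.filter_eq_empty_iff.2 fun l hl hlt => ?_
      have : (0 : ℝ) ≤ l := Nat.cast_nonneg l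
      linarith
    rw [this]
    simpa using sq_nonneg x
  · have hcard : ((Finset.Icc 1 m).filter (fun l : ℕ => (l : ℝ) < x)).card ≤ ⌊x⌋₊ := by
      have hsub : (Finset.Icc 1 m).filter (fun l : ℕ => (l : ℝ) < x) ⊆ Finset.Icc 1 ⌊x⌋₊ := by
        intro l hl
        rw [Finset.mem_filter, Finset.mem_Icc] at hl
        exact Finset.mem_Icc.2 ⟨hl.1.1, Nat.le_floor hl.2.le⟩
      simpa using Finset.card_le_card hsub
    have : (((Finset.Icc 1 m).filter (fun l : ℕ => (l : ℝ) < x)).card : ℝ) ≤ x :=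
      (Nat.cast_le.2 hcard).trans (Nat.floor_le hx.le)
    rw [sq]
    exact mul_le_mul_of_nonneg_right this hx.le

/-- In a window of length `m` the expected total excess is at most `(m + 1) E v²`. -/
lemma IsModel.lintegral_sum_excess_le (h : IsModel μ p ν X v) (a : ℤ) (m : ℕ) :
    ∑ e ∈ edgesIn a (a + m), ∫⁻ ω, ENNReal.ofReal (excess (fun e => v e ω) e) ∂μ ≤
      (m + 1 : ℕ) * ∫⁻ x, ENNReal.ofReal (x ^ 2) ∂ν := by
  have hmeas : ∀ l : ℤ, Measurable fun x : ℝ => ENNReal.ofReal (if (l : ℝ) < x then x else 0) :=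
    fun l => (Measurable.ite measurableSet_Ioi measurable_id measurable_const).ennreal_ofReal
  have hint : ∀ e : ℤ × ℤ, e.1 < e.2 → ∫⁻ ω, ENNReal.ofReal (excess (fun e => v e ω) e) ∂μ =
      ∫⁻ x, ENNReal.ofReal (if ((e.2 - e.1 : ℤ) : ℝ) < x then x else 0) ∂ν := by
    intro e he
    rw [← h.law_weight ⟨e, he⟩, lintegral_map (hmeas _) (h.measurable_weight ⟨e, he⟩)]
    rfl
  rw [Finset.sum_congr rfl fun e he => hint e (mem_edgesIn.1 he).2.1]
  refine (sum_edgesIn_le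
    (fun l => ∫⁻ x, ENNReal.ofReal (if (l : ℝ) < x then x else 0) ∂ν) a m).trans ?_
  gcongr
  rw [← lintegral_finsetSum _ fun (l : ℕ) _ => hmeas (l : ℤ)]
  refine lintegral_mono fun x => ?_
  rw [← ENNReal.ofReal_sum_of_nonneg]
  · exact ENNReal.ofReal_le_ofReal (by simpa using sum_ite_lt_le x m)
  · intro l hl
    have : (0 : ℝ) ≤ ((l : ℤ) : ℝ) := by positivity
    split_ifs <;> linarith

/-- Markov's inequality for the excess around a heavy edge `e`, the excess of the other edges being
independent of the weight of `e`. -/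
lemma IsModel.measure_heavy_excess_le [IsProbabilityMeasure μ] (h : IsModel μ p ν X v)
    {e : ℤ × ℤ} (he : e.1 < e.2) (a : ℤ) (m : ℕ) (x : ℝ) {R : ℝ} (hR : 0 < R) :
    μ {ω | x ≤ v e ω ∧ R ≤ ∑ e' ∈ (edgesIn a (a + m)).erase e, excess (fun e => v e ω) e'} ≤
      ν (Set.Ici x) * ((m + 1 : ℕ) * ∫⁻ x, ENNReal.ofReal (x ^ 2) ∂ν) / ENNReal.ofReal R := by
  set E := (edgesIn a (a + m)).erase e with hE
  have hlt : ∀ e' ∈ E, e'.1 < e'.2 := fun e' he' =>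
    (mem_edgesIn.1 (Finset.mem_of_mem_erase he')).2.1
  have hve := h.measurable_weight ⟨e, he⟩
  have hex : ∀ l : ℝ, Measurable fun y : ℝ => ENNReal.ofReal (if l < y then y else 0) :=
    fun l => (Measurable.ite measurableSet_Ioi measurable_id measurable_const).ennreal_ofReal
  have hexv : ∀ e' ∈ E, Measurable fun ω => ENNReal.ofReal (excess (fun e => v e ω) e') :=
    fun e' he' => (hex (edgeLength e')).comp (h.measurable_weight ⟨e', hlt e' he'⟩)
  have hind : Measurable fun y : ℝ => (Set.Ici x).indicator (1 : ℝ → ENNReal) y :=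
    measurable_one.indicator measurableSet_Ici
  set g : Ω → ENNReal := fun ω => (Set.Ici x).indicator (1 : ℝ → ENNReal) (v e ω) *
    ∑ e' ∈ E, ENNReal.ofReal (excess (fun e => v e ω) e') with hg
  have hgm : Measurable g := (hind.comp hve).mul (Finset.measurable_sum _ hexv)
  have hgint : ∫⁻ ω, g ω ∂μ ≤
      ν (Set.Ici x) * ((m + 1 : ℕ) * ∫⁻ x, ENNReal.ofReal (x ^ 2) ∂ν) := by
    have h1 : ∫⁻ ω, (Set.Ici x).indicator (1 : ℝ → ENNReal) (v e ω) ∂μ = ν (Set.Ici x) := by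
      rw [← h.law_weight ⟨e, he⟩, ← lintegral_indicator_one measurableSet_Ici,
        lintegral_map hind hve]
    calc ∫⁻ ω, g ω ∂μ = ∑ e' ∈ E, ∫⁻ ω, (Set.Ici x).indicator (1 : ℝ → ENNReal) (v e ω) *
          ENNReal.ofReal (excess (fun e => v e ω) e') ∂μ := by
          simp only [hg, Finset.mul_sum]
          exact lintegral_finsetSum _ fun e' he' => (hind.comp hve).mul (hexv e' he')
      _ = ∑ e' ∈ E, ν (Set.Ici x) * ∫⁻ ω, ENNReal.ofReal (excess (fun e => v e ω) e') ∂μ := by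
          refine Finset.sum_congr rfl fun e' he' => ?_
          have hindep : IndepFun (v e) (v e') μ := by
            have := (h.iIndepFun_edgeData.indepFun (Finset.ne_of_mem_erase he').symm).comp
              measurable_snd measurable_snd
            rw [edgeData_of_lt he, edgeData_of_lt (hlt e' he')] at this
            exact this
          have := lintegral_mul_eq_lintegral_mul_lintegral_of_indepFun (hind.comp hve)
            (hexv e' he') (hindep.comp hind (hex (edgeLength e')))
          rw [← h1]
          exact this
      _ ≤ _ := by
          rw [← Finset.mul_sum]
          gcongr
          refine le_trans ?_ (h.lintegral_sum_excess_le a m)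
          exact Finset.sum_le_sum_of_subset (Finset.erase_subset _ _)
  have hsub : {ω | x ≤ v e ω ∧ R ≤ ∑ e' ∈ E, excess (fun e => v e ω) e'} ⊆
      {ω | ENNReal.ofReal R ≤ g ω} := by
    rintro ω ⟨h1, h2⟩
    have : (Set.Ici x).indicator (1 : ℝ → ENNReal) (v e ω) = 1 :=
      Set.indicator_of_mem (by exact h1) _
    simp only [Set.mem_ofPred_eq, hg, this, one_mul]
    rw [← ENNReal.ofReal_sum_of_nonneg fun e' he' => excess_nonneg _ (hlt e' he')]
    exact ENNReal.ofReal_le_ofReal h2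
  refine (measure_mono hsub).trans ((meas_ge_le_lintegral_div hgm.aemeasurable
    (by simpa using hR) ENNReal.ofReal_ne_top).trans ?_)
  gcongr

end Independence

/-! ### Regularly varying tails -/

section Tail

/-- `T` is regularly varying at infinity with index `-s`. -/
def RegVarying (T : ℝ → ℝ) (s : ℝ) : Prop :=
  ∀ t : ℝ, 0 < t → Tendsto (fun x : ℝ => T (t * x) / T x) atTop (𝓝 (t ^ (-s)))

lemma RegVarying.pos {T : ℝ → ℝ} {s : ℝ} (h : RegVarying T s) (hT : Antitone T)
    (h0 : ∀ x, 0 ≤ T x) (x : ℝ) : 0 < T x := by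
  have h1 := h 1 one_pos
  rw [Real.one_rpow] at h1
  obtain ⟨y, hy, hxy⟩ := ((h1.eventually_ne one_ne_zero).and (eventually_ge_atTop x)).exists
  have : T y ≠ 0 := fun h => hy (by simp [h])
  exact ((h0 y).lt_of_ne' this).trans_le (hT hxy)

lemma exists_dyadic {x₀ x : ℝ} (h0 : 0 < x₀) (hx : x₀ ≤ x) :
    ∃ k : ℕ, 2 ^ k * x₀ ≤ x ∧ x < 2 ^ (k + 1) * x₀ := by
  obtain ⟨k, h1, h2⟩ := exists_nat_pow_near ((one_le_div h0).2 hx) (one_lt_two (α := ℝ))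
  exact ⟨k, (le_div_iff₀ h0).1 h1, (div_lt_iff₀ h0).1 h2⟩

lemma const_mul_rpow_le {C a b : ℝ} (hab : a < b) : ∀ᶠ x : ℝ in atTop, C * x ^ a ≤ x ^ b := by
  filter_upwards [(tendsto_rpow_atTop (sub_pos.2 hab)).eventually_ge_atTop C,
    eventually_gt_atTop 0] with x h1 h2
  calc C * x ^ a ≤ x ^ (b - a) * x ^ a := by gcongr
    _ = x ^ b := by rw [← Real.rpow_add h2]; ring_nf

lemma le_const_mul_rpow {C a b : ℝ} (hC : 0 < C) (hab : a < b) :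
    ∀ᶠ x : ℝ in atTop, x ^ a ≤ C * x ^ b := by
  filter_upwards [const_mul_rpow_le (C := C⁻¹) hab] with x h
  rwa [inv_mul_le_iff₀ hC] at h

/-- Potter's upper bound, up to powers of arbitrarily small exponent. -/
lemma RegVarying.le_rpow {T : ℝ → ℝ} {s : ℝ} (h : RegVarying T s) (hT : Antitone T)
    (h0 : ∀ x, 0 ≤ T x) (hs : 0 < s) {δ : ℝ} (hδ : 0 < δ) :
    ∀ᶠ x : ℝ in atTop, T x ≤ x ^ (-s + δ) := by
  have hpos := h.pos hT h0
  -- It suffices to treat small `δ`, for which the exponent is negative.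
  wlog hδs : δ < s generalizing δ
  · filter_upwards [this (half_pos hs) (by linarith), eventually_ge_atTop 1] with x hx h1
    exact hx.trans (Real.rpow_le_rpow_of_exponent_le h1 (by linarith))
  set r := s - δ / 2 with hr
  have hr0 : 0 < r := by rw [hr]; linarith
  have hlt : (2 : ℝ) ^ (-s) < 2 ^ (-r) :=
    Real.rpow_lt_rpow_of_exponent_lt one_lt_two (by rw [hr]; linarith)
  obtain ⟨x₀, hx₀⟩ := eventually_atTop.1 (((h 2 two_pos).eventually_lt_const hlt).and
    (eventually_gt_atTop 0))
  have hx₀0 : 0 < x₀ := (hx₀ x₀ le_rfl).2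
  have hstep : ∀ x ≥ x₀, T (2 * x) ≤ 2 ^ (-r) * T x := fun x hx =>
    ((div_lt_iff₀ (hpos x)).1 (hx₀ x hx).1).le
  have hiter : ∀ k : ℕ, T (2 ^ k * x₀) ≤ ((2 : ℝ) ^ k) ^ (-r) * T x₀ := by
    intro k
    induction k with
    | zero => simp
    | succ k ih =>
      have h1 : x₀ ≤ 2 ^ k * x₀ := le_mul_of_one_le_left hx₀0.le (one_le_pow₀ one_le_two)
      have h2 := hstep _ h1
      rw [← mul_assoc, ← pow_succ'] at h2
      refine h2.trans ?_
      rw [pow_succ', Real.mul_rpow two_pos.le (by positivity), mul_assoc]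
      gcongr
  filter_upwards [const_mul_rpow_le (C := (1 / (2 * x₀)) ^ (-r) * T x₀) (a := -r) (b := -s + δ)
    (by rw [hr]; linarith), eventually_ge_atTop x₀] with x hx1 hx2
  refine le_trans ?_ hx1
  obtain ⟨k, hk1, hk2⟩ := exists_dyadic hx₀0 hx2
  calc T x ≤ T (2 ^ k * x₀) := hT hk1
    _ ≤ ((2 : ℝ) ^ k) ^ (-r) * T x₀ := hiter k
    _ ≤ (1 / (2 * x₀) * x) ^ (-r) * T x₀ := by
        have : 1 / (2 * x₀) * x ≤ 2 ^ k := by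
          rw [one_div, inv_mul_le_iff₀ (by positivity)]
          rw [pow_succ] at hk2
          linarith
        have hx0 : 0 < x := by linarith
        exact mul_le_mul_of_nonneg_right
          (Real.rpow_le_rpow_of_nonpos (by positivity) this (by linarith)) (h0 _)
    _ = _ := by
        have hx0 : 0 < x := by linarith
        rw [Real.mul_rpow (by positivity) hx0.le]
        ring

/-- Potter's lower bound, up to powers of arbitrarily small exponent. -/
lemma RegVarying.rpow_le {T : ℝ → ℝ} {s : ℝ} (h : RegVarying T s) (hT : Antitone T)
    (h0 : ∀ x, 0 ≤ T x) (hs : 0 < s) {δ : ℝ} (hδ : 0 < δ) :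
    ∀ᶠ x : ℝ in atTop, x ^ (-s - δ) ≤ T x := by
  have hpos := h.pos hT h0
  set r := s + δ / 2 with hr
  have hr0 : 0 < r := by rw [hr]; linarith
  have hlt : (2 : ℝ) ^ (-r) < 2 ^ (-s) :=
    Real.rpow_lt_rpow_of_exponent_lt one_lt_two (by rw [hr]; linarith)
  obtain ⟨x₀, hx₀⟩ := eventually_atTop.1 (((h 2 two_pos).eventually_const_lt hlt).and
    (eventually_gt_atTop 0))
  have hx₀0 : 0 < x₀ := (hx₀ x₀ le_rfl).2
  have hstep : ∀ x ≥ x₀, 2 ^ (-r) * T x ≤ T (2 * x) := fun x hx =>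
    ((lt_div_iff₀ (hpos x)).1 (hx₀ x hx).1).le
  have hiter : ∀ k : ℕ, ((2 : ℝ) ^ k) ^ (-r) * T x₀ ≤ T (2 ^ k * x₀) := by
    intro k
    induction k with
    | zero => simp
    | succ k ih =>
      have h1 : x₀ ≤ 2 ^ k * x₀ := le_mul_of_one_le_left hx₀0.le (one_le_pow₀ one_le_two)
      have h2 := hstep _ h1
      rw [← mul_assoc, ← pow_succ'] at h2
      refine le_trans ?_ h2
      rw [pow_succ', Real.mul_rpow two_pos.le (by positivity), mul_assoc]
      gcongr
  filter_upwards [le_const_mul_rpow (C := (2 / x₀) ^ (-r) * T x₀) (a := -s - δ) (b := -r)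
    (mul_pos (by positivity) (hpos x₀)) (by rw [hr]; linarith),
    eventually_ge_atTop x₀] with x hx1 hx2
  refine hx1.trans ?_
  obtain ⟨k, hk1, hk2⟩ := exists_dyadic hx₀0 hx2
  have hx0 : 0 < x := by linarith
  calc _ = (2 / x₀ * x) ^ (-r) * T x₀ := by
        rw [Real.mul_rpow (by positivity) hx0.le]
        ring
    _ ≤ ((2 : ℝ) ^ (k + 1)) ^ (-r) * T x₀ := by
        have : (2 : ℝ) ^ (k + 1) ≤ 2 / x₀ * x := by
          rw [div_mul_eq_mul_div, le_div_iff₀ hx₀0, pow_succ]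
          linarith
        exact mul_le_mul_of_nonneg_right
          (Real.rpow_le_rpow_of_nonpos (by positivity) this (by linarith)) (h0 _)
    _ ≤ T (2 ^ (k + 1) * x₀) := hiter _
    _ ≤ T x := hT hk2.le

variable {ν : Measure ℝ} [IsProbabilityMeasure ν] {s : ℝ}

lemma antitone_tail : Antitone fun x => ν.real (Set.Ioi x) :=
  fun _ _ h => measureReal_mono (Set.Ioi_subset_Ioi h)

/-- The tail of `ν` is regularly varying with index `-s`. -/
def HeavyTail (ν : Measure ℝ) (s : ℝ) : Prop := RegVarying (fun x => ν.real (Set.Ioi x)) s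

lemma one_sub_cdf (x : ℝ) : 1 - cdf ν x = ν.real (Set.Ioi x) := by
  rw [cdf_eq_real, ← Set.compl_Iic, probReal_compl_eq_one_sub measurableSet_Iic]

lemma HeavyTail.pos (h : HeavyTail ν s) (x : ℝ) : 0 < ν.real (Set.Ioi x) :=
  RegVarying.pos h antitone_tail (fun _ => measureReal_nonneg) x

lemma HeavyTail.rpow_le (h : HeavyTail ν s) (hs : 0 < s) {δ : ℝ} (hδ : 0 < δ) :
    ∀ᶠ x : ℝ in atTop, x ^ (-s - δ) ≤ ν.real (Set.Ici x) := by
  filter_upwards [RegVarying.rpow_le h antitone_tail (fun _ => measureReal_nonneg) hs hδ] with x hx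
  exact hx.trans (measureReal_mono Set.Ioi_subset_Ici_self)

lemma HeavyTail.le_rpow (h : HeavyTail ν s) (hs : 0 < s) {δ : ℝ} (hδ : 0 < δ) :
    ∀ᶠ x : ℝ in atTop, ν.real (Set.Ici x) ≤ x ^ (-s + δ) := by
  have h1 := RegVarying.le_rpow h antitone_tail (fun _ => measureReal_nonneg) hs (half_pos hδ)
  have h2 : Tendsto (fun x : ℝ => (1 / 2) * x) atTop atTop :=
    tendsto_id.const_mul_atTop (by norm_num)
  filter_upwards [h2.eventually h1, eventually_gt_atTop 0,
    const_mul_rpow_le (C := (1 / 2 : ℝ) ^ (-s + δ / 2)) (a := -s + δ / 2) (b := -s + δ)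
      (by linarith)] with x hx hx0 hx1
  refine le_trans (measureReal_mono fun y (hy : x ≤ y) => ?_) (hx.trans ?_)
  · exact Set.mem_Ioi.2 (by linarith)
  · rwa [Real.mul_rpow (by norm_num) hx0.le]

/-- Regular variation forbids atoms, or clusters, that carry a fixed proportion of the tail: on
multiplicatively short intervals far out, `ν` puts little mass compared with what lies beyond. -/
lemma HeavyTail.exists_Icc_le (h : HeavyTail ν s) (hs : 0 < s) {η : ℝ} (hη : 0 < η) :
    ∃ κ > 0, ∃ x₀ > 0, ∀ y ≥ x₀, ∀ r ≤ κ * y,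
      ν (Set.Icc y (y + r)) ≤ ENNReal.ofReal η * ν (Set.Ioi (y + r)) := by
  -- The interval `[y, l y]` is compared with `(y / l, l y]`, and `l ^ (-2 s) > 1 / (1 + η)`.
  set l : ℝ := (1 + η) ^ (1 / (4 * s)) with hl
  have hl1 : 1 < l := Real.one_lt_rpow (by linarith) (by positivity)
  have hl0 : 0 < l := by linarith
  have hll : (l * l) ^ (-s) = (1 + η) ^ (-(1 / 2) : ℝ) := by
    rw [hl, ← Real.rpow_add (by linarith), ← Real.rpow_mul (by linarith)]
    congr 1
    field_simp
    norm_num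
  have hlt : (1 + η)⁻¹ < (l * l) ^ (-s) := by
    rw [hll, ← Real.rpow_neg_one]
    exact Real.rpow_lt_rpow_of_exponent_lt (by linarith) (by norm_num)
  obtain ⟨x₁, hx₁⟩ := eventually_atTop.1
    ((h (l * l) (mul_pos hl0 hl0)).eventually_const_lt hlt)
  refine ⟨l - 1, by linarith, max 1 (l * x₁), by positivity, fun y hy r hr => ?_⟩
  have hy1 : 0 < y := by linarith [le_max_left 1 (l * x₁)]
  have hu : x₁ ≤ y / l := by
    rw [le_div_iff₀ hl0]
    linarith [le_max_right 1 (l * x₁)]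
  have h1 := hx₁ _ hu
  rw [lt_div_iff₀ (h.pos _), show l * l * (y / l) = l * y by field_simp] at h1
  have h2 : ν.real (Set.Icc y (y + r)) + ν.real (Set.Ioi (l * y)) ≤ ν.real (Set.Ioi (y / l)) := by
    rw [← measureReal_union]
    · refine measureReal_mono ?_
      have : y / l < y := div_lt_self hy1 hl1
      rintro z (hz | hz)
      · exact lt_of_lt_of_le this hz.1
      · have hz' : l * y < z := hz
        refine Set.mem_Ioi.2 ?_
        nlinarith
    · rw [Set.disjoint_left]
      rintro z hz hz'
      have hz'' : l * y < z := hz'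
      linarith [hz.2]
    · exact measurableSet_Ioi
  have h3 : ν.real (Set.Ioi (l * y)) ≤ ν.real (Set.Ioi (y + r)) := antitone_tail (by linarith)
  have h4 : ν.real (Set.Icc y (y + r)) ≤ η * ν.real (Set.Ioi (y + r)) := by
    rw [inv_mul_lt_iff₀ (by linarith)] at h1
    nlinarith
  rw [← ofReal_measureReal, ← ofReal_measureReal (s := Set.Ioi (y + r)),
    ← ENNReal.ofReal_mul hη.le]
  exact ENNReal.ofReal_le_ofReal h4

/-- A regularly varying tail of index `s > 2` has a finite second moment. -/
lemma HeavyTail.lintegral_sq_lt_top (h : HeavyTail ν s) (hs : 2 < s) (hpos : ν (Set.Iic 0) = 0) :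
    ∫⁻ x, ENNReal.ofReal (x ^ 2) ∂ν < ⊤ := by
  have h0 : ∀ᵐ x ∂ν, 0 < x := by
    rw [ae_iff]
    simpa [Set.Iic] using hpos
  have h1 := lintegral_rpow_eq_lintegral_meas_lt_mul ν (f := fun x : ℝ => x)
    (h0.mono fun x hx => hx.le) aemeasurable_id (p := 2) two_pos
  simp only [Real.rpow_two] at h1
  rw [h1]
  refine ENNReal.mul_lt_top ENNReal.ofReal_lt_top ?_
  set δ := (s - 2) / 2 with hδ
  obtain ⟨x₀, hx₀⟩ := eventually_atTop.1 ((h.le_rpow (by linarith) (δ := δ)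
    (by rw [hδ]; linarith)).and (eventually_gt_atTop 0))
  have hx₀0 : 0 < x₀ := (hx₀ x₀ le_rfl).2
  rw [← Set.Ioc_union_Ioi_eq_Ioi hx₀0.le]
  refine (lintegral_union_le _ _ _).trans_lt (ENNReal.add_lt_top.2 ⟨?_, ?_⟩)
  · calc _ ≤ ∫⁻ t in Set.Ioc 0 x₀, ENNReal.ofReal x₀ := by
          refine setLIntegral_mono measurable_const fun t ht => ?_
          refine (mul_le_of_le_one_left' prob_le_one).trans (ENNReal.ofReal_le_ofReal ?_)
          norm_num
          exact ht.2
      _ < ⊤ := by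
          rw [setLIntegral_const, Real.volume_Ioc]
          exact ENNReal.mul_lt_top ENNReal.ofReal_lt_top ENNReal.ofReal_lt_top
  · calc _ ≤ ∫⁻ t in Set.Ioi x₀, ENNReal.ofReal (t ^ (-s + δ + 1)) := by
          refine setLIntegral_mono (by fun_prop) fun t ht => ?_
          have ht' : x₀ < t := ht
          have ht0 : 0 < t := by linarith
          have h2 : ν {a | t < a} ≤ ENNReal.ofReal (t ^ (-s + δ)) := by
            refine (measure_mono (t := Set.Ici t) fun a (ha : t < a) => ha.le).trans ?_
            rw [← ofReal_measureReal]
            exact ENNReal.ofReal_le_ofReal (hx₀ t ht'.le).1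
          refine (mul_le_mul_left h2 _).trans ?_
          rw [← ENNReal.ofReal_mul (by positivity)]
          refine ENNReal.ofReal_le_ofReal (le_of_eq ?_)
          rw [← Real.rpow_add ht0]
          norm_num
      _ < ⊤ := by
          have := (integrableOn_Ioi_rpow_of_lt (a := -s + δ + 1) (by rw [hδ]; linarith) hx₀0)
          exact this.lintegral_lt_top

end Tail

/-! ### Events of high probability -/

section HighProbability

lemma tendsto_zero_of_le_ofReal {f : ℕ → ENNReal} {g : ℕ → ℝ} (hg : Tendsto g atTop (𝓝 0))
    (h : ∀ᶠ n in atTop, f n ≤ ENNReal.ofReal (g n)) : Tendsto f atTop (𝓝 0) := by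
  have hg' : Tendsto (fun n => ENNReal.ofReal (g n)) atTop (𝓝 0) := by
    simpa using ENNReal.tendsto_ofReal hg
  exact tendsto_of_tendsto_of_tendsto_of_le_of_le' tendsto_const_nhds hg'
    (Eventually.of_forall fun _ => zero_le) h

lemma tendsto_natCast_rpow {e : ℝ} (he : 0 < e) :
    Tendsto (fun n : ℕ => (n : ℝ) ^ e) atTop atTop :=
  (tendsto_rpow_atTop he).comp tendsto_natCast_atTop_atTop

lemma tendsto_const_mul_natCast_rpow (C : ℝ) {e : ℝ} (he : e < 0) :
    Tendsto (fun n : ℕ => C * (n : ℝ) ^ e) atTop (𝓝 0) := by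
  have := ((tendsto_rpow_neg_atTop (neg_pos.2 he)).comp
    (tendsto_natCast_atTop_atTop (R := ℝ))).const_mul C
  simpa [Function.comp_def] using this

variable {Ω : Type*} [MeasurableSpace Ω] {μ : Measure Ω}
  {p s : ℝ} {ν : Measure ℝ} [IsProbabilityMeasure ν] {X : ℤ × ℤ → Ω → Bool} {v : ℤ × ℤ → Ω → ℝ}

/-- With high probability the weight of every edge is smaller, by a factor that is a power of `n`,
than the larger of its length and `h = n ^ (1 / (s - 1) + ε)`. Indeed the expected number of
exceptions is about `n ∑ₗ max (l, h) ^ (-s)`, hence about `n h ^ (1 - s)`. -/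
lemma IsModel.tendsto_exists_heavy (h : IsModel μ p ν X v) (hν : HeavyTail ν s) (hs : 2 < s)
    {ε : ℝ} (hε : 0 < ε) :
    ∃ a, 0 < a ∧ a < 1 / (s - 1) ∧ Tendsto (fun n : ℕ => μ {ω | ∃ e ∈ edgesIn 0 n,
      (n : ℝ) ^ (-a) * max (edgeLength e) ((n : ℝ) ^ (1 / (s - 1) + ε)) ≤ v e ω})
      atTop (𝓝 0) := by
  set α := 1 / (s - 1) with hα
  have hα0 : 0 < α := one_div_pos.2 (by linarith)
  have hαs : α * (s - 1) = 1 := one_div_mul_cancel (by linarith)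
  -- `δ` is the error in Potter's bound, and `a` the power of `n` to be gained.
  set δ := ε * (s - 1) / (8 * (α + ε)) with hδ
  have hs1 : 0 < s - 1 := by linarith
  have hδ0 : 0 < δ := by positivity
  have hδ1 : 2 * δ * (α + ε) = ε * (s - 1) / 4 := by
    rw [hδ]; field_simp; norm_num
  have hδ2 : 8 * δ ≤ s - 1 := by
    refine le_of_mul_le_mul_right ?_ (show 0 < α + ε by linarith)
    nlinarith
  set a := min (α / 2) (ε * (s - 1) / (4 * s)) with ha
  have hs0 : 0 < s := by linarith
  have ha0 : 0 < a := lt_min (by positivity) (by positivity)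
  have haα : a ≤ α / 2 := min_le_left _ _
  have has : a * s ≤ ε * (s - 1) / 4 := by
    calc a * s ≤ ε * (s - 1) / (4 * s) * s := by gcongr; exact min_le_right _ _
      _ = _ := by field_simp
  refine ⟨a, ha0, by linarith, ?_⟩
  set K : ℝ := ∑' l : ℕ, 1 / (l : ℝ) ^ (1 + δ) with hK
  have hsum : Summable fun l : ℕ => 1 / (l : ℝ) ^ (1 + δ) :=
    Real.summable_one_div_nat_rpow.2 (by linarith)
  set E := 1 + a * (s - δ) - (α + ε) * (s - 1 - 2 * δ) with hE
  have hE0 : E < 0 := by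
    have : 0 < ε * (s - 1) := by positivity
    have : 0 < a * δ := by positivity
    nlinarith
  refine tendsto_zero_of_le_ofReal (tendsto_const_mul_natCast_rpow (2 * K) hE0) ?_
  obtain ⟨x₀, hx₀⟩ := eventually_atTop.1 (hν.le_rpow hs0 hδ0)
  filter_upwards [eventually_ge_atTop 1,
    (tendsto_natCast_rpow (show 0 < α + ε - a by linarith)).eventually_ge_atTop x₀] with n hn hnx
  have hn1 : (1 : ℝ) ≤ n := by exact_mod_cast hn
  have hn0 : (0 : ℝ) < n := by linarith
  set b := (n : ℝ) ^ (α + ε) with hb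
  have hb0 : 0 < b := by positivity
  refine (h.measure_exists_weight_ge_le n _).trans ?_
  have hle := sum_edgesIn_le (fun l => ν (Set.Ici ((n : ℝ) ^ (-a) * max (l : ℝ) b))) 0 n
  rw [zero_add] at hle
  refine hle.trans ?_
  have hterm : ∀ l ∈ Finset.Icc 1 n, ν (Set.Ici ((n : ℝ) ^ (-a) * max (((l : ℕ) : ℤ) : ℝ) b)) ≤
      ENNReal.ofReal ((n : ℝ) ^ (a * (s - δ)) * b ^ (-(s - 1 - 2 * δ)) *
        (1 / (l : ℝ) ^ (1 + δ))) := by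
    intro l hl
    have hl1 : (1 : ℝ) ≤ l := by exact_mod_cast (Finset.mem_Icc.1 hl).1
    rw [Int.cast_natCast]
    set m := max (l : ℝ) b with hm
    have hm0 : 0 < m := lt_max_of_lt_right hb0
    have hx : x₀ ≤ (n : ℝ) ^ (-a) * m := by
      refine hnx.trans ?_
      calc (n : ℝ) ^ (α + ε - a) = (n : ℝ) ^ (-a) * b := by
            rw [hb, ← Real.rpow_add hn0]; ring_nf
        _ ≤ _ := by gcongr; exact le_max_right _ _
    rw [← ofReal_measureReal]
    refine ENNReal.ofReal_le_ofReal ((hx₀ _ hx).trans ?_)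
    rw [Real.mul_rpow (by positivity) hm0.le, ← Real.rpow_mul hn0.le, mul_assoc]
    -- The part `l ^ (-(1 + δ))` of the bound makes the sum over the lengths converge.
    have h1 : m ^ (-s + δ) = m ^ (-(s - 1 - 2 * δ)) * m ^ (-(1 + δ)) := by
      rw [← Real.rpow_add hm0]; ring_nf
    have h2 : m ^ (-(s - 1 - 2 * δ)) ≤ b ^ (-(s - 1 - 2 * δ)) :=
      Real.rpow_le_rpow_of_nonpos hb0 (le_max_right _ _) (by linarith)
    have h3 : m ^ (-(1 + δ)) ≤ 1 / (l : ℝ) ^ (1 + δ) := by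
      rw [one_div, ← Real.rpow_neg (by linarith)]
      exact Real.rpow_le_rpow_of_nonpos (by linarith) (le_max_left _ _) (by linarith)
    rw [h1, show -a * (-s + δ) = a * (s - δ) by ring]
    gcongr
  calc _ ≤ ((n + 1 : ℕ) : ENNReal) * ∑ l ∈ Finset.Icc 1 n, ENNReal.ofReal
        ((n : ℝ) ^ (a * (s - δ)) * b ^ (-(s - 1 - 2 * δ)) * (1 / (l : ℝ) ^ (1 + δ))) := by
        gcongr with l hl
        exact hterm l hl
    _ = ENNReal.ofReal ((n + 1 : ℕ) * ∑ l ∈ Finset.Icc 1 n,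
        ((n : ℝ) ^ (a * (s - δ)) * b ^ (-(s - 1 - 2 * δ)) * (1 / (l : ℝ) ^ (1 + δ)))) := by
        rw [ENNReal.ofReal_mul (by positivity), ENNReal.ofReal_natCast,
          ENNReal.ofReal_sum_of_nonneg fun l _ => by positivity]
    _ ≤ _ := by
        refine ENNReal.ofReal_le_ofReal ?_
        rw [← Finset.mul_sum]
        have h1 : ∑ l ∈ Finset.Icc 1 n, 1 / (l : ℝ) ^ (1 + δ) ≤ K :=
          hsum.sum_le_tsum _ fun l _ => by positivity
        have h2 : ((n + 1 : ℕ) : ℝ) ≤ 2 * n := by push_cast; linarith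
        calc _ ≤ 2 * n * ((n : ℝ) ^ (a * (s - δ)) * b ^ (-(s - 1 - 2 * δ)) * K) := by gcongr
          _ = 2 * K * ((n : ℝ) ^ (1 : ℝ) * (n : ℝ) ^ (a * (s - δ)) * b ^ (-(s - 1 - 2 * δ))) := by
              rw [Real.rpow_one]; ring
          _ = _ := by
              rw [hb, ← Real.rpow_mul hn0.le, ← Real.rpow_add hn0, ← Real.rpow_add hn0, hE]
              congr 2
              ring

variable [IsProbabilityMeasure μ]

/-- The points at distance at least `n ^ ε` are well connected: a pair fails to be so with a
probability that is exponentially small in `n ^ ε`. -/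
lemma IsModel.tendsto_not_wellConnected (h : IsModel μ p ν X v) (hp : 0 < p) (hν : HeavyTail ν s)
    {ε : ℝ} (hε : 0 < ε) :
    Tendsto (fun n : ℕ => μ {ω | ¬ WellConnected X v n (⌈(n : ℝ) ^ ε⌉₊ : ℕ) ω}) atTop (𝓝 0) := by
  set b := (p * ν.real (Set.Ici 1)) ^ 2 with hb
  have hb0 : 0 < b := by
    have : 0 < ν.real (Set.Ici 1) :=
      (hν.pos 1).trans_le (measureReal_mono Set.Ioi_subset_Ici_self)
    positivity
  have hlim : Tendsto (fun n : ℕ => 4 * Real.exp b *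
      (((n : ℝ) ^ ε) ^ (2 / ε) * Real.exp (-b * (n : ℝ) ^ ε))) atTop (𝓝 0) := by
    have := ((tendsto_rpow_mul_exp_neg_mul_atTop_nhds_zero (2 / ε) b hb0).comp
      (tendsto_natCast_rpow hε)).const_mul (4 * Real.exp b)
    simpa [Function.comp_def] using this
  refine tendsto_zero_of_le_ofReal hlim ?_
  filter_upwards [eventually_ge_atTop 1] with n hn
  have hn1 : (1 : ℝ) ≤ n := by exact_mod_cast hn
  set d := ⌈(n : ℝ) ^ ε⌉₊ with hd
  have hd1 : 1 ≤ d := Nat.one_le_ceil_iff.2 (by positivity)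
  refine (h.measure_not_wellConnected_le hp.le n d).trans ?_
  have h1 : ENNReal.ofReal (1 - b) ≤ ENNReal.ofReal (Real.exp (-b)) :=
    ENNReal.ofReal_le_ofReal (Real.one_sub_le_exp_neg b)
  calc ((n + 1 : ℕ) : ENNReal) ^ 2 * ENNReal.ofReal (1 - b) ^ (d - 1)
      ≤ ENNReal.ofReal ((n + 1 : ℕ) : ℝ) ^ 2 * ENNReal.ofReal (Real.exp (-b)) ^ (d - 1) := by
        rw [ENNReal.ofReal_natCast]
        gcongr
    _ = ENNReal.ofReal (((n + 1 : ℕ) : ℝ) ^ 2 * Real.exp (-b) ^ (d - 1)) := by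
        rw [ENNReal.ofReal_mul (by positivity), ENNReal.ofReal_pow (by positivity),
          ENNReal.ofReal_pow (by positivity)]
    _ ≤ _ := by
        refine ENNReal.ofReal_le_ofReal ?_
        have h2 : Real.exp (-b) ^ (d - 1) ≤ Real.exp b * Real.exp (-b * (n : ℝ) ^ ε) := by
          rw [← Real.exp_nat_mul, ← Real.exp_add, Real.exp_le_exp, Nat.cast_sub hd1]
          have : (n : ℝ) ^ ε ≤ d := Nat.le_ceil _
          push_cast
          nlinarith
        have h3 : ((n : ℝ) ^ ε) ^ (2 / ε) = (n : ℝ) ^ 2 := by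
          rw [← Real.rpow_mul (by positivity), mul_div_cancel₀ _ hε.ne', Real.rpow_two]
        have h4 : ((n + 1 : ℕ) : ℝ) ^ 2 ≤ 4 * (n : ℝ) ^ 2 := by
          push_cast
          nlinarith
        rw [h3]
        calc _ ≤ 4 * (n : ℝ) ^ 2 * (Real.exp b * Real.exp (-b * (n : ℝ) ^ ε)) := by gcongr
          _ = _ := by ring

lemma injective_shear : Function.Injective fun q : ℤ × ℤ => (q.1, q.1 + q.2) := by
  rintro ⟨i, l⟩ ⟨i', l'⟩ h
  simp only [Prod.mk.injEq] at h ⊢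
  omega

/-- The edges `(i, i + k)` with `i` in `[2L, n - 4L]` and `k` in `[L, 2L]`: long edges, with
room for a detour of length `2L` on both sides. -/
noncomputable def bypassEdges (n L : ℕ) : Finset (ℤ × ℤ) :=
  (Finset.Icc (2 * L : ℤ) (n - 4 * L) ×ˢ Finset.Icc (L : ℤ) (2 * L)).map
    ⟨_, injective_shear⟩

lemma mem_bypassEdges {n L : ℕ} {e : ℤ × ℤ} (he : e ∈ bypassEdges n L) :
    2 * L ≤ e.1 ∧ e.2 + 2 * L ≤ n ∧ L ≤ e.2 - e.1 ∧ e.2 - e.1 ≤ 2 * L := by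
  obtain ⟨q, hq, rfl⟩ := Finset.mem_map.1 he
  rw [Finset.mem_product, Finset.mem_Icc, Finset.mem_Icc] at hq
  simp only [Function.Embedding.coeFn_mk]
  omega

lemma card_bypassEdges (n L : ℕ) :
    (bypassEdges n L).card = ((n : ℤ) - 6 * L + 1).toNat * (L + 1) := by
  rw [bypassEdges, Finset.card_map, Finset.card_product, Int.card_Icc, Int.card_Icc]
  congr 1
  · congr 1; ring
  · omega

lemma card_bypassEdges_le (n L : ℕ) : (bypassEdges n L).card ≤ (n + 1) * (L + 1) := by
  rw [card_bypassEdges]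
  gcongr
  omega

lemma le_card_bypassEdges {n L : ℕ} (h : 12 * L ≤ n) :
    (n : ℝ) / 2 * L ≤ ((bypassEdges n L).card : ℝ) := by
  rw [card_bypassEdges, Nat.cast_mul]
  have h1 : (n : ℝ) / 2 ≤ ((((n : ℤ) - 6 * L + 1).toNat : ℕ) : ℝ) := by
    have h2 : n ≤ 2 * ((n : ℤ) - 6 * L + 1).toNat := by omega
    have h3 : (n : ℝ) ≤ 2 * (((n : ℤ) - 6 * L + 1).toNat : ℕ) := by exact_mod_cast h2
    linarith
  gcongr
  linarith

/-- With high probability some edge of length of order `L = n ^ (α - c)`, where `α = 1 / (s - 1)`,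
has a weight of higher order `n ^ (α - θ c)`. There are of order `n L` edges to choose from, which
is enough for `θ > 1 / s`. -/
lemma IsModel.tendsto_forall_not_presentGe (h : IsModel μ p ν X v) (hp : 0 < p)
    (hν : HeavyTail ν s) (hs : 2 < s) {c θ : ℝ} (hc : 0 < c) (hcα : c < 1 / (s - 1))
    (hθ : 1 < s * θ) (hθ1 : θ < 1) :
    Tendsto (fun n : ℕ => μ {ω | ∀ e ∈ bypassEdges n ⌈(n : ℝ) ^ (1 / (s - 1) - c)⌉₊,
      ¬ PresentGe X v ((n : ℝ) ^ (1 / (s - 1) - θ * c)) e ω}) atTop (𝓝 0) := by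
  set α := 1 / (s - 1) with hα
  have hα0 : 0 < α := one_div_pos.2 (by linarith)
  have hαs : α * (s - 1) = 1 := one_div_mul_cancel (by linarith)
  have hα1 : α < 1 := by rw [hα, div_lt_one (by linarith)]; linarith
  have hθ0 : 0 < θ := pos_of_mul_pos_right (one_pos.trans hθ) (by linarith)
  have hθc : θ * c < c := by nlinarith
  have hθc0 : 0 < θ * c := by positivity
  set δ := c * (s * θ - 1) / (2 * α) with hδ
  have hδ0 : 0 < δ := div_pos (mul_pos hc (by linarith)) (by linarith)
  have hδα : δ * α = c * (s * θ - 1) / 2 := by rw [hδ]; field_simp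
  set g := 1 + (α - c) + (α - θ * c) * (-s - δ) with hg
  have hg0 : 0 < g := by
    have h1 : g = c * (s * θ - 1) - δ * α + δ * (θ * c) := by rw [hg]; linear_combination -hαs
    have h2 : 0 < c * (s * θ - 1) := mul_pos hc (by linarith)
    have h3 : 0 < δ * (θ * c) := by positivity
    rw [h1, hδα]
    linarith
  have hlim : Tendsto (fun n : ℕ => Real.exp (-(p / 2 * (n : ℝ) ^ g))) atTop (𝓝 0) :=
    Real.tendsto_exp_neg_atTop_nhds_zero.comp
      ((tendsto_natCast_rpow hg0).const_mul_atTop (by positivity))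
  refine tendsto_zero_of_le_ofReal hlim ?_
  have hM : Tendsto (fun n : ℕ => (n : ℝ) ^ (α - θ * c)) atTop atTop :=
    tendsto_natCast_rpow (by linarith)
  filter_upwards [eventually_ge_atTop 1, hM.eventually (hν.rpow_le (by linarith) hδ0),
    tendsto_natCast_atTop_atTop.eventually
      (const_mul_rpow_le (C := 24) (show α - c < 1 by linarith))] with n hn hnM hnL
  have hn1 : (1 : ℝ) ≤ n := by exact_mod_cast hn
  have hn0 : (0 : ℝ) < n := by linarith
  set L := ⌈(n : ℝ) ^ (α - c)⌉₊ with hL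
  have hL1 : (n : ℝ) ^ (α - c) ≤ L := Nat.le_ceil _
  have hL2 : (L : ℝ) ≤ 2 * (n : ℝ) ^ (α - c) := by
    have h1 : (1 : ℝ) ≤ (n : ℝ) ^ (α - c) := Real.one_le_rpow hn1 (by linarith)
    have h2 := Nat.ceil_lt_add_one (show 0 ≤ (n : ℝ) ^ (α - c) by positivity)
    linarith
  have h12 : 12 * L ≤ n := by
    rw [Real.rpow_one] at hnL
    have : (12 * L : ℝ) ≤ n := by linarith
    exact_mod_cast this
  rw [h.measure_forall_not_presentGe hp.le _ _ fun e he => by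
    have := mem_bypassEdges he
    have : 0 < L := Nat.ceil_pos.2 (by positivity)
    omega]
  set q := p * ν.real (Set.Ici ((n : ℝ) ^ (α - θ * c))) with hq
  have hqle : p * (n : ℝ) ^ ((α - θ * c) * (-s - δ)) ≤ q := by
    rw [hq, Real.rpow_mul hn0.le]
    gcongr
  have hcard := le_card_bypassEdges h12
  calc ENNReal.ofReal (1 - q) ^ (bypassEdges n L).card
      ≤ ENNReal.ofReal (Real.exp (-q)) ^ (bypassEdges n L).card := by
        gcongr
        exact Real.one_sub_le_exp_neg q
    _ = ENNReal.ofReal (Real.exp (-((bypassEdges n L).card * q))) := by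
        rw [← ENNReal.ofReal_pow (by positivity), ← Real.exp_nat_mul]
        congr 2
        ring
    _ ≤ _ := by
        refine ENNReal.ofReal_le_ofReal (Real.exp_le_exp.2 (neg_le_neg ?_))
        calc p / 2 * (n : ℝ) ^ g = (n : ℝ) / 2 * (n : ℝ) ^ (α - c) *
              (p * (n : ℝ) ^ ((α - θ * c) * (-s - δ))) := by
              rw [hg, Real.rpow_add hn0, Real.rpow_add hn0, Real.rpow_one]; ring
          _ ≤ (n : ℝ) / 2 * L * q := by gcongr
          _ ≤ _ := by gcongr

/-- With high probability no edge of `bypassEdges` with a weight of at least `n ^ (α - θ c)` is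
surrounded by an excess of the same order. The union bound over all these edges requires
`θ < 2 / (s + 1)`. -/
lemma IsModel.tendsto_exists_heavy_excess (h : IsModel μ p ν X v)
    (hν : HeavyTail ν s) (hs : 2 < s) (hpos : ν (Set.Iic 0) = 0) {c θ : ℝ} (hc : 0 < c)
    (hcα : c < 1 / (s - 1)) (hθ0 : 0 < θ) (hθ : (s + 1) * θ < 2) (hθ1 : θ < 1) :
    Tendsto (fun n : ℕ => μ {ω | ∃ e ∈ bypassEdges n ⌈(n : ℝ) ^ (1 / (s - 1) - c)⌉₊,
      (n : ℝ) ^ (1 / (s - 1) - θ * c) ≤ v e ω ∧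
      (n : ℝ) ^ (1 / (s - 1) - θ * c) / 2 ≤
        ∑ e' ∈ (edgesIn (e.1 - 2 * (⌈(n : ℝ) ^ (1 / (s - 1) - c)⌉₊ : ℕ))
          (e.2 + 2 * (⌈(n : ℝ) ^ (1 / (s - 1) - c)⌉₊ : ℕ))).erase e,
          excess (fun e => v e ω) e'}) atTop (𝓝 0) := by
  set α := 1 / (s - 1) with hα
  have hα0 : 0 < α := one_div_pos.2 (by linarith)
  have hαs : α * (s - 1) = 1 := one_div_mul_cancel (by linarith)
  have hθc : θ * c < c := by nlinarith
  have hθc0 : 0 < θ * c := by positivity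
  set δ := c * (2 - (s + 1) * θ) / (2 * α) with hδ
  have hδ0 : 0 < δ := div_pos (mul_pos hc (by linarith)) (by linarith)
  have hδα : δ * α = c * (2 - (s + 1) * θ) / 2 := by rw [hδ]; field_simp
  set g := 1 + (α - c) + (α - c) + (α - θ * c) * (-s + δ) - (α - θ * c) with hg
  have hg0 : g < 0 := by
    have h1 : g = -(c * (2 - (s + 1) * θ)) + δ * α - δ * (θ * c) := by
      rw [hg]; linear_combination -hαs
    have h2 : 0 < c * (2 - (s + 1) * θ) := mul_pos hc (by linarith)
    have h3 : 0 < δ * (θ * c) := by positivity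
    rw [h1, hδα]
    linarith
  set K := (∫⁻ x, ENNReal.ofReal (x ^ 2) ∂ν).toReal with hK
  have hK' : ∫⁻ x, ENNReal.ofReal (x ^ 2) ∂ν = ENNReal.ofReal K :=
    (ENNReal.ofReal_toReal (hν.lintegral_sq_lt_top hs hpos).ne).symm
  have hK0 : 0 ≤ K := ENNReal.toReal_nonneg
  refine tendsto_zero_of_le_ofReal (tendsto_const_mul_natCast_rpow (156 * K) hg0) ?_
  have hM : Tendsto (fun n : ℕ => (n : ℝ) ^ (α - θ * c)) atTop atTop :=
    tendsto_natCast_rpow (by linarith)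
  filter_upwards [eventually_ge_atTop 1, hM.eventually (hν.le_rpow (by linarith) hδ0)]
    with n hn hnM
  have hn1 : (1 : ℝ) ≤ n := by exact_mod_cast hn
  have hn0 : (0 : ℝ) < n := by linarith
  set L := ⌈(n : ℝ) ^ (α - c)⌉₊ with hL
  have hL0 : (1 : ℝ) ≤ (n : ℝ) ^ (α - c) := Real.one_le_rpow hn1 (by linarith)
  have hL2 : (L : ℝ) ≤ 2 * (n : ℝ) ^ (α - c) := by
    have h2 := Nat.ceil_lt_add_one (show 0 ≤ (n : ℝ) ^ (α - c) by positivity)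
    linarith
  set M := (n : ℝ) ^ (α - θ * c) with hMdef
  have hM0 : 0 < M := by positivity
  have hterm : ∀ e ∈ bypassEdges n L, μ {ω | M ≤ v e ω ∧ M / 2 ≤
      ∑ e' ∈ (edgesIn (e.1 - 2 * L) (e.2 + 2 * L)).erase e, excess (fun e => v e ω) e'} ≤
      ENNReal.ofReal (M ^ (-s + δ) * ((6 * L + 1) * K) / (M / 2)) := by
    intro e he
    have hb := mem_bypassEdges he
    have hLpos : 0 < L := Nat.ceil_pos.2 (by positivity)
    obtain ⟨m, hm⟩ : ∃ m : ℕ, e.2 + 2 * L = e.1 - 2 * L + m :=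
      ⟨(e.2 - e.1 + 4 * L).toNat, by omega⟩
    have hm6 : m ≤ 6 * L := by omega
    rw [hm]
    refine (h.measure_heavy_excess_le (by omega) _ m M (half_pos hM0)).trans ?_
    rw [hK', ENNReal.ofReal_div_of_pos (half_pos hM0), ENNReal.ofReal_mul (by positivity),
      ENNReal.ofReal_mul (by positivity)]
    have h1 : ν (Set.Ici M) ≤ ENNReal.ofReal (M ^ (-s + δ)) := by
      rw [← ofReal_measureReal]
      exact ENNReal.ofReal_le_ofReal hnM
    have h2 : ((m + 1 : ℕ) : ENNReal) ≤ ENNReal.ofReal (6 * L + 1) := by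
      rw [← ENNReal.ofReal_natCast]
      refine ENNReal.ofReal_le_ofReal ?_
      exact_mod_cast (by omega : m + 1 ≤ 6 * L + 1)
    gcongr
  have hset : {ω | ∃ e ∈ bypassEdges n L, M ≤ v e ω ∧ M / 2 ≤
      ∑ e' ∈ (edgesIn (e.1 - 2 * L) (e.2 + 2 * L)).erase e, excess (fun e => v e ω) e'} =
      ⋃ e ∈ bypassEdges n L, {ω | M ≤ v e ω ∧ M / 2 ≤
      ∑ e' ∈ (edgesIn (e.1 - 2 * L) (e.2 + 2 * L)).erase e, excess (fun e => v e ω) e'} := by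
    ext ω
    simp only [Set.mem_iUnion, Set.mem_ofPred_eq, exists_prop]
  rw [hset]
  refine (measure_biUnion_finset_le _ _).trans ((Finset.sum_le_sum hterm).trans ?_)
  rw [Finset.sum_const, nsmul_eq_mul, ← ENNReal.ofReal_natCast,
    ← ENNReal.ofReal_mul (Nat.cast_nonneg _)]
  refine ENNReal.ofReal_le_ofReal ?_
  have hcard : ((bypassEdges n L).card : ℝ) ≤ (n + 1) * (L + 1) := by
    exact_mod_cast card_bypassEdges_le n L
  calc _ ≤ (2 * n * (3 * (n : ℝ) ^ (α - c))) *
        (M ^ (-s + δ) * ((13 * (n : ℝ) ^ (α - c)) * K) / (M / 2)) := by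
        have h1 : ((bypassEdges n L).card : ℝ) ≤ 2 * n * (3 * (n : ℝ) ^ (α - c)) := by
          refine hcard.trans ?_
          gcongr <;> linarith
        have h2 : (6 * L + 1 : ℝ) ≤ 13 * (n : ℝ) ^ (α - c) := by linarith
        gcongr
    _ = 156 * K * ((n : ℝ) ^ (1 : ℝ) * (n : ℝ) ^ (α - c) * (n : ℝ) ^ (α - c) *
        M ^ (-s + δ) / M) := by
        rw [Real.rpow_one]; field_simp; ring
    _ = _ := by
        rw [hMdef, ← Real.rpow_mul hn0.le, ← Real.rpow_add hn0, ← Real.rpow_add hn0,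
          ← Real.rpow_add hn0, ← Real.rpow_sub hn0]

end HighProbability

/-! ### The longest and the heaviest edge of a geodesic -/

section LongestEdge

variable {Ω : Type*} [MeasurableSpace Ω] {μ : Measure Ω}

lemma tendsto_measure_union {A B : ℕ → Set Ω} (hA : Tendsto (fun n => μ (A n)) atTop (𝓝 0))
    (hB : Tendsto (fun n => μ (B n)) atTop (𝓝 0)) :
    Tendsto (fun n => μ (A n ∪ B n)) atTop (𝓝 0) := by
  have := hA.add hB
  rw [add_zero] at this
  exact tendsto_of_tendsto_of_tendsto_of_le_of_le tendsto_const_nhds this (fun _ => zero_le)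
    fun n => measure_union_le _ _

lemma tendsto_measure_mono {A B : ℕ → Set Ω} (hA : Tendsto (fun n => μ (A n)) atTop (𝓝 0))
    (h : ∀ᶠ n in atTop, ∀ᵐ ω ∂μ, ω ∈ B n → ω ∈ A n) :
    Tendsto (fun n => μ (B n)) atTop (𝓝 0) :=
  tendsto_of_tendsto_of_tendsto_of_le_of_le' tendsto_const_nhds hA
    (Eventually.of_forall fun _ => zero_le) (h.mono fun _ hn => measure_mono_ae hn)

/-- Bounds up to powers of arbitrarily small exponent are convergence of the logarithms. -/
lemma tendstoInMeasure_log {x : ℕ → Ω → ℝ} {α : ℝ} (hα : 0 < α)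
    (h : ∀ c, 0 < c → c < α → Tendsto (fun n : ℕ =>
      μ {ω | ¬ ((n : ℝ) ^ (α - c) ≤ x n ω ∧ x n ω ≤ (n : ℝ) ^ (α + c))}) atTop (𝓝 0)) :
    TendstoInMeasure μ (fun (n : ℕ) ω => Real.log (x n ω) / Real.log n) atTop (fun _ => α) := by
  rw [tendstoInMeasure_iff_dist]
  intro ε hε
  set c := min (ε / 2) (α / 2) with hc
  have hc0 : 0 < c := lt_min (by linarith) (by linarith)
  have hcε : c ≤ ε / 2 := min_le_left _ _
  have hcα : c ≤ α / 2 := min_le_right _ _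
  refine tendsto_measure_mono (h c hc0 (by linarith)) ?_
  filter_upwards [eventually_ge_atTop 2] with n hn
  refine Eventually.of_forall fun ω hω hcon => ?_
  have hn2 : (2 : ℝ) ≤ n := by exact_mod_cast hn
  have hn0 : (0 : ℝ) < n := by linarith
  have hlog : 0 < Real.log n := Real.log_pos (by linarith)
  have hx : 0 < x n ω := lt_of_lt_of_le (by positivity) hcon.1
  have h1 : (α - c) * Real.log n ≤ Real.log (x n ω) := by
    rw [← Real.log_rpow hn0]
    exact Real.log_le_log (by positivity) hcon.1
  have h2 : Real.log (x n ω) ≤ (α + c) * Real.log n := by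
    rw [← Real.log_rpow hn0]
    exact Real.log_le_log hx hcon.2
  rw [← le_div_iff₀ hlog] at h1
  rw [← div_le_iff₀ hlog] at h2
  have hω' : ε ≤ dist (Real.log (x n ω) / Real.log n) α := hω
  rw [Real.dist_eq] at hω'
  have : |Real.log (x n ω) / Real.log n - α| ≤ c := abs_le.2 ⟨by linarith, by linarith⟩
  linarith

lemma ceil_rpow_le {a b : ℝ} (ha : 0 < a) (hab : a < b) :
    ∀ᶠ n : ℕ in atTop, (⌈(n : ℝ) ^ a⌉₊ : ℝ) ≤ (n : ℝ) ^ b := by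
  filter_upwards [eventually_ge_atTop 1, tendsto_natCast_atTop_atTop.eventually
    (const_mul_rpow_le (C := 2) hab)] with n hn h
  have hn1 : (1 : ℝ) ≤ n := by exact_mod_cast hn
  have h1 : (1 : ℝ) ≤ (n : ℝ) ^ a := Real.one_le_rpow hn1 ha.le
  have h2 := Nat.ceil_lt_add_one (show 0 ≤ (n : ℝ) ^ a by linarith)
  linarith

lemma ceil_rpow_pos {n : ℕ} (hn : 1 ≤ n) (a : ℝ) : 0 < ⌈(n : ℝ) ^ a⌉₊ := by
  have : (0 : ℝ) < n := by exact_mod_cast hn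
  exact Nat.ceil_pos.2 (by positivity)

variable [IsProbabilityMeasure μ]
  {p s : ℝ} {ν : Measure ℝ} [IsProbabilityMeasure ν] {X : ℤ × ℤ → Ω → Bool} {v : ℤ × ℤ → Ω → ℝ}

/-- With high probability there is a path, and even one of weight at least `0`. -/
lemma IsModel.tendsto_not_exists_path (h : IsModel μ p ν X v) (hp : 0 < p) (hν : HeavyTail ν s) :
    Tendsto (fun n : ℕ => μ {ω | ¬ ∃ π, IsOpenPath X 0 n ω π ∧
      0 ≤ pathWeight (fun e => v e ω) π}) atTop (𝓝 0) := by
  refine tendsto_measure_mono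
    (h.tendsto_not_wellConnected hp hν (show (0 : ℝ) < 1 / 2 by norm_num)) ?_
  filter_upwards [eventually_ge_atTop 1,
    ceil_rpow_le (show (0 : ℝ) < 1 / 2 by norm_num) (show (1 / 2 : ℝ) < 1 by norm_num)] with n hn hd
  refine Eventually.of_forall fun ω hω hcon => hω ?_
  rw [Real.rpow_one, Nat.cast_le] at hd
  obtain ⟨π, hπ, hw⟩ := hcon.exists_path_pos (i := 0) (j := n)
    (by exact_mod_cast ceil_rpow_pos hn _) le_rfl le_rfl (by omega)
  exact ⟨π, hπ, hw.le⟩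

/-- The edges of a geodesic are neither longer nor heavier than `n ^ (1 / (s - 1) + ε)`: an edge
that long would have to be heavy, by `WellConnected.edgeLength_lt`, but there is no such edge. -/
lemma IsModel.tendsto_exists_large_edge (h : IsModel μ p ν X v) (hp : 0 < p)
    (hν : HeavyTail ν s) (hs : 2 < s) {ε : ℝ} (hε : 0 < ε) :
    Tendsto (fun n : ℕ => μ {ω | ∃ π, IsGeodesic X v 0 n ω π ∧ ∃ e ∈ π,
      (n : ℝ) ^ (1 / (s - 1) + ε) ≤ edgeLength e ∨ (n : ℝ) ^ (1 / (s - 1) + ε) ≤ v e ω})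
      atTop (𝓝 0) := by
  obtain ⟨a, ha0, haα, ha⟩ := h.tendsto_exists_heavy hν hs hε
  refine tendsto_measure_mono
    (tendsto_measure_union ha (h.tendsto_not_wellConnected hp hν (half_pos ha0))) ?_
  filter_upwards [eventually_ge_atTop 1, ceil_rpow_le (half_pos ha0) (half_lt_self ha0)]
    with n hn hd
  refine Eventually.of_forall fun ω hω => ?_
  by_contra hcon
  simp only [Set.mem_union, Set.mem_ofPred_eq, not_or, not_not, not_exists, not_and, not_le] at hcon
  obtain ⟨hheavy, hconn⟩ := hcon
  obtain ⟨π, hπ, e, he, hbig⟩ := hω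
  have hn1 : (1 : ℝ) ≤ n := by exact_mod_cast hn
  have hn0 : (0 : ℝ) < n := by linarith
  set b := (n : ℝ) ^ (1 / (s - 1) + ε) with hb
  have hb0 : 0 < b := by positivity
  have hab : (n : ℝ) ^ a ≤ b := Real.rpow_le_rpow_of_exponent_le hn1 (by linarith)
  have hv := hheavy e (mem_edgesIn.2 (hπ.1.1.bounds e he))
  rw [Real.rpow_neg hn0.le, ← div_eq_inv_mul, lt_div_iff₀ (by positivity)] at hv
  have hlen : edgeLength e < b := by
    by_contra! hle
    rw [max_eq_left hle] at hv
    have h1 : edgeLength e < (⌈(n : ℝ) ^ (a / 2)⌉₊ : ℝ) * v e ω := by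
      refine hconn.edgeLength_lt (by exact_mod_cast ceil_rpow_pos hn _) hπ he ?_
      have : ((⌈(n : ℝ) ^ (a / 2)⌉₊ : ℤ) : ℝ) ≤ ((e.2 - e.1 : ℤ) : ℝ) := by
        rw [Int.cast_natCast]
        exact (hd.trans hab).trans hle
      exact_mod_cast this
    have hv0 : 0 ≤ v e ω := by
      by_contra! hneg
      have h2 : (⌈(n : ℝ) ^ (a / 2)⌉₊ : ℝ) * v e ω ≤ 0 :=
        mul_nonpos_of_nonneg_of_nonpos (Nat.cast_nonneg _) hneg.le
      linarith
    have h3 : (⌈(n : ℝ) ^ (a / 2)⌉₊ : ℝ) * v e ω ≤ (n : ℝ) ^ a * v e ω := by gcongr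
    linarith
  rw [max_eq_right hlen.le] at hv
  have h1a : 1 ≤ (n : ℝ) ^ a := Real.one_le_rpow hn1 ha0.le
  rcases hbig with hbig | hbig
  · linarith
  · nlinarith

/-- A geodesic has an edge of length at least `n ^ (1 / (s - 1) - c)`, since otherwise it could be
rerouted through an exceptionally heavy edge. -/
lemma IsModel.tendsto_forall_edgeLength_lt (h : IsModel μ p ν X v) (hp : 0 < p)
    (hν : HeavyTail ν s) (hs : 2 < s) (hpos : ν (Set.Iic 0) = 0) {c : ℝ} (hc : 0 < c)
    (hcα : c < 1 / (s - 1)) :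
    Tendsto (fun n : ℕ => μ {ω | ∃ π, IsGeodesic X v 0 n ω π ∧
      ∀ e ∈ π, edgeLength e < (n : ℝ) ^ (1 / (s - 1) - c)}) atTop (𝓝 0) := by
  have hs0 : 0 < s := by linarith
  obtain ⟨θ, hθ1, hθ2⟩ : ∃ θ, 1 / s < θ ∧ θ < 2 / (s + 1) := exists_between (by
    rw [div_lt_div_iff₀ (by linarith) (by linarith)]; linarith)
  have hθ0 : 0 < θ := (one_div_pos.2 hs0).trans hθ1
  rw [div_lt_iff₀' hs0] at hθ1
  rw [lt_div_iff₀' (by linarith)] at hθ2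
  have hθ3 : θ < 1 := by nlinarith
  have hθc : θ * c < c := by nlinarith
  refine tendsto_measure_mono (tendsto_measure_union
    (tendsto_measure_union
      (h.tendsto_forall_not_presentGe hp hν hs hc hcα hθ1 hθ3)
      (h.tendsto_exists_heavy_excess hν hs hpos hc hcα hθ0 hθ2 hθ3))
    (h.tendsto_not_wellConnected hp hν (sub_pos.2 hcα))) ?_
  set α := 1 / (s - 1) with hα
  filter_upwards [eventually_ge_atTop 1, tendsto_natCast_atTop_atTop.eventually
    (const_mul_rpow_le (C := 24) (show α - c < α - θ * c by linarith))] with n hn hLM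
  refine Eventually.of_forall fun ω hω => ?_
  by_contra hcon
  obtain ⟨π, hπ, hlen⟩ := hω
  have hn1 : (1 : ℝ) ≤ n := by exact_mod_cast hn
  set L := ⌈(n : ℝ) ^ (α - c)⌉₊ with hL
  set M := (n : ℝ) ^ (α - θ * c) with hM
  have hL0 : 0 < L := ceil_rpow_pos hn _
  have hL1 : (n : ℝ) ^ (α - c) ≤ L := Nat.le_ceil _
  have hL2 : 12 * (L : ℝ) ≤ M := by
    have h1 : (1 : ℝ) ≤ (n : ℝ) ^ (α - c) := Real.one_le_rpow hn1 (by linarith)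
    have h2 := Nat.ceil_lt_add_one (show 0 ≤ (n : ℝ) ^ (α - c) by linarith)
    linarith
  simp only [Set.mem_union, not_or] at hcon
  obtain ⟨⟨hA, hB⟩, hC⟩ := hcon
  replace hA : ∃ e ∈ bypassEdges n L, PresentGe X v M e ω := by
    by_contra! hno
    exact hA hno
  obtain ⟨e, he, hX, hv⟩ := hA
  have hS : ∑ e' ∈ (edgesIn (e.1 - 2 * L) (e.2 + 2 * L)).erase e,
      excess (fun e => v e ω) e' < M / 2 := by
    by_contra! hle
    exact hB ⟨e, he, hv, hle⟩
  have hconn : WellConnected X v n L ω := by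
    by_contra hno
    exact hC hno
  have hb := mem_bypassEdges he
  obtain ⟨e', he', hle⟩ := hconn.exists_long_edge (by exact_mod_cast hL0) le_rfl hπ hb.1 hb.2.1
    hb.2.2.1 hb.2.2.2 hX (by rw [Int.cast_natCast]; linarith)
  have hlt := hlen e' he'
  have : ((L : ℤ) : ℝ) ≤ edgeLength e' := by
    unfold edgeLength
    exact_mod_cast hle
  rw [Int.cast_natCast] at this
  linarith

/-- A geodesic has an edge of weight at least `n ^ (1 / (s - 1) - c)`: its longest edge. -/
lemma IsModel.tendsto_forall_weight_lt (h : IsModel μ p ν X v) (hp : 0 < p)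
    (hν : HeavyTail ν s) (hs : 2 < s) (hpos : ν (Set.Iic 0) = 0) {c : ℝ} (hc : 0 < c)
    (hcα : c < 1 / (s - 1)) :
    Tendsto (fun n : ℕ => μ {ω | ∃ π, IsGeodesic X v 0 n ω π ∧
      ∀ e ∈ π, v e ω < (n : ℝ) ^ (1 / (s - 1) - c)}) atTop (𝓝 0) := by
  refine tendsto_measure_mono (tendsto_measure_union
    (h.tendsto_forall_edgeLength_lt hp hν hs hpos (half_pos hc) (by linarith))
    (h.tendsto_not_wellConnected hp hν (show 0 < c / 4 by linarith))) ?_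
  set α := 1 / (s - 1) with hα
  filter_upwards [eventually_ge_atTop 1,
    ceil_rpow_le (show 0 < c / 4 by linarith) (show c / 4 < c / 2 by linarith)] with n hn hd
  refine Eventually.of_forall fun ω hω => ?_
  by_contra hcon
  simp only [Set.mem_union, Set.mem_ofPred_eq, not_or, not_not, not_exists, not_and, not_lt,
    not_forall] at hcon
  obtain ⟨π, hπ, hw⟩ := hω
  obtain ⟨hlong, hconn⟩ := hcon
  obtain ⟨e, he, hlen⟩ := hlong π hπ
  have hn1 : (1 : ℝ) ≤ n := by exact_mod_cast hn
  have hn0 : (0 : ℝ) < n := by linarith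
  have h1 : edgeLength e < (⌈(n : ℝ) ^ (c / 4)⌉₊ : ℝ) * v e ω := by
    refine hconn.edgeLength_lt (by exact_mod_cast ceil_rpow_pos hn _) hπ he ?_
    have : ((⌈(n : ℝ) ^ (c / 4)⌉₊ : ℤ) : ℝ) ≤ ((e.2 - e.1 : ℤ) : ℝ) := by
      rw [Int.cast_natCast]
      exact (hd.trans (Real.rpow_le_rpow_of_exponent_le hn1 (by linarith))).trans hlen
    exact_mod_cast this
  have h2 : (⌈(n : ℝ) ^ (c / 4)⌉₊ : ℝ) * v e ω ≤ (n : ℝ) ^ (c / 2) * (n : ℝ) ^ (α - c) := by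
    have := (hw e he).le
    calc (⌈(n : ℝ) ^ (c / 4)⌉₊ : ℝ) * v e ω ≤ ⌈(n : ℝ) ^ (c / 4)⌉₊ * (n : ℝ) ^ (α - c) := by
          gcongr
      _ ≤ _ := by gcongr
  rw [← Real.rpow_add hn0, show c / 2 + (α - c) = α - c / 2 by ring] at h2
  linarith

lemma le_pathMax_of_not_forall_lt {f : ℤ × ℤ → ℝ} {π : List (ℤ × ℤ)} {x : ℝ}
    (h : ¬ ∀ e ∈ π, f e < x) : x ≤ pathMax f π := by
  push Not at h
  obtain ⟨e, he, hx⟩ := h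
  exact hx.trans (le_pathMax he)

/-- Almost sure geodesics are geodesics with high probability. -/
lemma IsModel.tendsto_not_isGeodesic (h : IsModel μ p ν X v) (hp : 0 < p) (hν : HeavyTail ν s)
    {γ : ℕ → Ω → List (ℤ × ℤ)}
    (hγ : ∀ n : ℕ, ∀ᵐ ω ∂μ, (∃ π, IsOpenPath X 0 n ω π) → IsGeodesic X v 0 n ω (γ n ω)) :
    Tendsto (fun n : ℕ => μ {ω | ¬ IsGeodesic X v 0 n ω (γ n ω)}) atTop (𝓝 0) := by
  refine tendsto_measure_mono (h.tendsto_not_exists_path hp hν) (Eventually.of_forall fun n => ?_)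
  filter_upwards [hγ n] with ω hω hno hex
  obtain ⟨π, hπ, -⟩ := hex
  exact hno (hω ⟨π, hπ⟩)

theorem IsModel.tendstoInMeasure_longestEdge (h : IsModel μ p ν X v) (hp : 0 < p)
    (hν : HeavyTail ν s) (hs : 2 < s) (hpos : ν (Set.Iic 0) = 0) {γ : ℕ → Ω → List (ℤ × ℤ)}
    (hγ : ∀ n : ℕ, ∀ᵐ ω ∂μ, (∃ π, IsOpenPath X 0 n ω π) → IsGeodesic X v 0 n ω (γ n ω)) :
    TendstoInMeasure μ (fun (n : ℕ) ω => Real.log (longestEdge (γ n ω)) / Real.log n) atTop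
      (fun _ => 1 / (s - 1)) := by
  refine tendstoInMeasure_log (one_div_pos.2 (by linarith)) fun c hc hcα => ?_
  refine tendsto_measure_mono (tendsto_measure_union (h.tendsto_not_isGeodesic hp hν hγ)
    (tendsto_measure_union (h.tendsto_forall_edgeLength_lt hp hν hs hpos hc hcα)
      (h.tendsto_exists_large_edge hp hν hs hc))) (Eventually.of_forall fun n => ?_)
  refine Eventually.of_forall fun ω hω => ?_
  by_contra hcon
  simp only [Set.mem_union, Set.mem_ofPred_eq, not_or, not_not] at hcon
  obtain ⟨hgeo, h1, h2⟩ := hcon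
  refine hω ⟨le_pathMax_of_not_forall_lt fun hlt => h1 ⟨_, hgeo, hlt⟩,
    pathMax_le (by positivity) fun e he => ?_⟩
  by_contra! hlt
  exact h2 ⟨_, hgeo, e, he, Or.inl hlt.le⟩

theorem IsModel.tendstoInMeasure_heaviestEdge (h : IsModel μ p ν X v) (hp : 0 < p)
    (hν : HeavyTail ν s) (hs : 2 < s) (hpos : ν (Set.Iic 0) = 0) {γ : ℕ → Ω → List (ℤ × ℤ)}
    (hγ : ∀ n : ℕ, ∀ᵐ ω ∂μ, (∃ π, IsOpenPath X 0 n ω π) → IsGeodesic X v 0 n ω (γ n ω)) :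
    TendstoInMeasure μ (fun (n : ℕ) ω => Real.log (heaviestEdge v ω (γ n ω)) / Real.log n) atTop
      (fun _ => 1 / (s - 1)) := by
  refine tendstoInMeasure_log (one_div_pos.2 (by linarith)) fun c hc hcα => ?_
  refine tendsto_measure_mono (tendsto_measure_union (h.tendsto_not_isGeodesic hp hν hγ)
    (tendsto_measure_union (h.tendsto_forall_weight_lt hp hν hs hpos hc hcα)
      (h.tendsto_exists_large_edge hp hν hs hc))) (Eventually.of_forall fun n => ?_)
  refine Eventually.of_forall fun ω hω => ?_
  by_contra hcon
  simp only [Set.mem_union, Set.mem_ofPred_eq, not_or, not_not] at hcon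
  obtain ⟨hgeo, h1, h2⟩ := hcon
  refine hω ⟨le_pathMax_of_not_forall_lt fun hlt => h1 ⟨_, hgeo, hlt⟩,
    pathMax_le (by positivity) fun e he => ?_⟩
  by_contra! hlt
  exact h2 ⟨_, hgeo, e, he, Or.inr hlt.le⟩

end LongestEdge

/-! ### Anti-concentration of the passage time -/

section Champion

variable {Ω Ω' : Type*} {X : ℤ × ℤ → Ω → Bool} {v : ℤ × ℤ → Ω → ℝ}
  {X' : ℤ × ℤ → Ω' → Bool} {v' : ℤ × ℤ → Ω' → ℝ} {i j : ℤ} {ω : Ω} {ω' : Ω'}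

lemma IsPath.pathWeight_congr {f g : ℤ × ℤ → ℝ} {π : List (ℤ × ℤ)} (h : IsPath i j π)
    (hfg : ∀ e : ℤ × ℤ, e.1 < e.2 → f e = g e) : pathWeight f π = pathWeight g π := by
  rw [pathWeight, pathWeight, List.map_congr_left fun e he => hfg e (h.edge_lt e he)]

lemma isOpenPath_congr (hX : ∀ e : ℤ × ℤ, e.1 < e.2 → X e ω = X' e ω') (π : List (ℤ × ℤ)) :
    IsOpenPath X i j ω π ↔ IsOpenPath X' i j ω' π := by
  refine and_congr_right fun h => forall₂_congr fun e he => ?_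
  rw [hX e (h.edge_lt e he)]

lemma isGeodesic_congr (hX : ∀ e : ℤ × ℤ, e.1 < e.2 → X e ω = X' e ω')
    (hv : ∀ e : ℤ × ℤ, e.1 < e.2 → v e ω = v' e ω') (π : List (ℤ × ℤ)) :
    IsGeodesic X v i j ω π ↔ IsGeodesic X' v' i j ω' π := by
  unfold IsGeodesic
  rw [isOpenPath_congr hX]
  refine and_congr_right fun h => forall_congr' fun π' => ?_
  rw [isOpenPath_congr hX]
  refine forall_congr' fun h' => ?_
  rw [h.1.pathWeight_congr hv, h'.1.pathWeight_congr hv]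

/-- The edge `e` lies on some geodesic from `i` to `j`. -/
def OnGeodesic (X : ℤ × ℤ → Ω → Bool) (v : ℤ × ℤ → Ω → ℝ) (i j : ℤ) (ω : Ω) (e : ℤ × ℤ) : Prop :=
  ∃ π, IsGeodesic X v i j ω π ∧ e ∈ π

/-- The champion is the heaviest among all the edges that lie on some geodesic from `i` to `j`, ties
being broken by an enumeration of `ℤ × ℤ`. In this way it is unique, and no choice of a geodesic is
needed. -/
def Champion (X : ℤ × ℤ → Ω → Bool) (v : ℤ × ℤ → Ω → ℝ) (i j : ℤ) (ω : Ω) (e : ℤ × ℤ) : Prop :=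
  OnGeodesic X v i j ω e ∧ ∀ e', OnGeodesic X v i j ω e' →
    toLex (v e' ω, Encodable.encode e') ≤ toLex (v e ω, Encodable.encode e)

lemma Champion.eq {e e' : ℤ × ℤ} (h : Champion X v i j ω e) (h' : Champion X v i j ω e') :
    e = e' := by
  have := le_antisymm (h'.2 e h.1) (h.2 e' h'.1)
  rw [toLex_inj, Prod.mk.injEq] at this
  exact Encodable.encode_injective this.2

lemma Champion.weight_le {e e' : ℤ × ℤ} (h : Champion X v i j ω e)
    (h' : OnGeodesic X v i j ω e') : v e' ω ≤ v e ω := by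
  rcases Prod.Lex.toLex_le_toLex.1 (h.2 e' h') with hlt | heq
  · exact hlt.le
  · exact heq.1.le

lemma exists_champion {e : ℤ × ℤ} (h : OnGeodesic X v i j ω e) :
    ∃ e' ∈ edgesIn i j, Champion X v i j ω e' := by
  classical
  have hmem : ∀ e', OnGeodesic X v i j ω e' → e' ∈ edgesIn i j := fun e' ⟨π, hπ, he⟩ =>
    mem_edgesIn.2 (hπ.1.1.bounds e' he)
  obtain ⟨e', he', hmax⟩ := ((edgesIn i j).filter fun e => OnGeodesic X v i j ω e).exists_max_image
    (fun e => toLex (v e ω, Encodable.encode e)) ⟨e, Finset.mem_filter.2 ⟨hmem e h, h⟩⟩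
  rw [Finset.mem_filter] at he'
  exact ⟨e', he'.1, he'.2, fun e'' h'' => hmax e'' (Finset.mem_filter.2 ⟨hmem e'' h'', h''⟩)⟩

variable {ω₁ ω₂ : Ω} {e : ℤ × ℤ}

lemma pathWeight_of_eq_off (hv : ∀ e', e' ≠ e → v e' ω₂ = v e' ω₁) {π : List (ℤ × ℤ)}
    (hπ : IsPath i j π) : pathWeight (fun e => v e ω₂) π =
      pathWeight (fun e => v e ω₁) π + if e ∈ π then v e ω₂ - v e ω₁ else 0 := by
  rw [pathWeight_eq_sum _ hπ, pathWeight_eq_sum _ hπ, ← sub_eq_iff_eq_add',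
    ← Finset.sum_sub_distrib]
  split_ifs with he
  · refine Finset.sum_eq_single_of_mem e (List.mem_toFinset.2 he) fun e' _ hne => ?_
    rw [hv e' hne, sub_self]
  · refine Finset.sum_eq_zero fun e' he' => ?_
    rw [hv e' (by rintro rfl; exact he (List.mem_toFinset.1 he')), sub_self]

/-- Raising the weight of an edge `e` of a geodesic keeps the geodesics through `e`, and no
other path becomes a geodesic. -/
lemma isGeodesic_of_raise (hX : ∀ e', X e' ω₂ = X e' ω₁) (hv : ∀ e', e' ≠ e → v e' ω₂ = v e' ω₁)
    (hlt : v e ω₁ < v e ω₂) (he : OnGeodesic X v i j ω₁ e) (π : List (ℤ × ℤ)) :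
    IsGeodesic X v i j ω₂ π ↔ IsGeodesic X v i j ω₁ π ∧ e ∈ π := by
  have hopen : ∀ π, IsOpenPath X i j ω₂ π ↔ IsOpenPath X i j ω₁ π :=
    fun π => isOpenPath_congr (fun e' _ => hX e') π
  have hle : ∀ π, IsOpenPath X i j ω₁ π → pathWeight (fun e => v e ω₂) π ≤
      pathWeight (fun e => v e ω₁) π + (v e ω₂ - v e ω₁) := by
    intro π hπ
    rw [pathWeight_of_eq_off hv hπ.1]
    split_ifs <;> linarith
  constructor
  · intro hπ
    obtain ⟨π₀, hπ₀, heπ₀⟩ := he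
    have hπ1 := (hopen π).1 hπ.1
    have h1 := hπ.2 π₀ ((hopen _).2 hπ₀.1)
    have h2 := hπ₀.2 π hπ1
    rw [pathWeight_of_eq_off hv hπ₀.1.1, if_pos heπ₀, pathWeight_of_eq_off hv hπ1.1] at h1
    have heπ : e ∈ π := by
      by_contra hno
      rw [if_neg hno] at h1
      linarith
    rw [if_pos heπ] at h1
    exact ⟨⟨hπ1, fun π' hπ' => (hπ₀.2 π' hπ').trans (by linarith)⟩, heπ⟩
  · rintro ⟨hπ, heπ⟩
    refine ⟨(hopen π).2 hπ.1, fun π' hπ' => ?_⟩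
    have hπ'1 := (hopen π').1 hπ'
    have h1 := hπ.2 π' hπ'1
    rw [pathWeight_of_eq_off hv hπ.1.1, if_pos heπ]
    linarith [hle π' hπ'1]

/-- A champion stays the champion when its weight is raised. -/
lemma Champion.raise (hX : ∀ e', X e' ω₂ = X e' ω₁) (hv : ∀ e', e' ≠ e → v e' ω₂ = v e' ω₁)
    (hlt : v e ω₁ < v e ω₂) (h : Champion X v i j ω₁ e) : Champion X v i j ω₂ e := by
  obtain ⟨π₀, hπ₀, heπ₀⟩ := h.1
  refine ⟨⟨π₀, (isGeodesic_of_raise hX hv hlt h.1 π₀).2 ⟨hπ₀, heπ₀⟩, heπ₀⟩, ?_⟩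
  -- There are fewer competitors than before, with unchanged weights.
  rintro e' ⟨π, hπ, he'⟩
  rcases eq_or_ne e' e with rfl | hne
  · exact le_rfl
  have hπ1 := (isGeodesic_of_raise hX hv hlt h.1 π).1 hπ
  rw [hv e' hne]
  exact Prod.Lex.toLex_le_toLex.2 (Or.inl ((h.weight_le ⟨π, hπ1.1, he'⟩).trans_lt hlt))

end Champion

section AntiConcentration

/-- If `ν` is spread out beyond `M` on the scale `r`, then a part `D` of diameter at most `r` of an
upper set `U` beyond `M` carries only a small proportion of the mass of `U`. -/
lemma measure_le_of_isUpperSet {ν : Measure ℝ} {M r : ℝ} {c : ENNReal}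
    (hν : ∀ y ≥ M, ν (Set.Icc y (y + r)) ≤ c * ν (Set.Ioi (y + r))) (hr : 0 ≤ r)
    {U D : Set ℝ} (hU : IsUpperSet U) (hUM : ∀ x ∈ U, M ≤ x) (hDU : D ⊆ U)
    (hD : ∀ x ∈ D, ∀ x' ∈ D, x' ≤ x + r) : ν D ≤ c * ν U := by
  rcases D.eq_empty_or_nonempty with rfl | hne
  · simp
  have hbdd : BddBelow D := ⟨M, fun x hx => hUM x (hDU hx)⟩
  have h1 : D ⊆ Set.Icc (sInf D) (sInf D + r) := by
    refine fun x hx => ⟨csInf_le hbdd hx, ?_⟩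
    have : x - r ≤ sInf D := le_csInf hne fun x' hx' => by linarith [hD x' hx' x hx]
    linarith
  have h2 : Set.Ioi (sInf D + r) ⊆ U := by
    intro z hz
    have hz' : sInf D < z := by linarith [Set.mem_Ioi.1 hz]
    obtain ⟨x, hx, hxz⟩ := exists_lt_of_csInf_lt hne hz'
    exact hU hxz.le (hDU hx)
  calc ν D ≤ ν (Set.Icc (sInf D) (sInf D + r)) := measure_mono h1
    _ ≤ c * ν (Set.Ioi (sInf D + r)) :=
        hν _ (le_csInf hne fun x hx => hUM x (hDU hx))
    _ ≤ c * ν U := by gcongr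

/-- The space of all configurations of presence indicators and weights. -/
abbrev Config : Type := ℤ × ℤ → Bool × ℝ

/-- The presence indicators on the configuration space. -/
def configPresent (e : ℤ × ℤ) (ζ : Config) : Bool := (ζ e).1

/-- The weights on the configuration space. -/
def configWeight (e : ℤ × ℤ) (ζ : Config) : ℝ := (ζ e).2

lemma measurable_configPresent (e : ℤ × ℤ) : Measurable (configPresent e) :=
  (measurable_pi_apply e).fst

lemma measurable_configWeight (e : ℤ × ℤ) : Measurable (configWeight e) :=
  (measurable_pi_apply e).snd

lemma measurable_configPathWeight (π : List (ℤ × ℤ)) :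
    Measurable fun ζ : Config => pathWeight (fun e => configWeight e ζ) π := by
  induction π with
  | nil => exact measurable_const
  | cons a π ih =>
    simp only [pathWeight_cons]
    exact (measurable_configWeight a).add ih

lemma measurable_isOpenPath (i j : ℤ) (π : List (ℤ × ℤ)) :
    Measurable fun ζ : Config => IsOpenPath configPresent i j ζ π := by
  refine measurable_const.and (Measurable.forall fun e => measurable_const.imp ?_)
  exact measurableSet_setOfPred.1 (measurable_configPresent e (measurableSet_singleton true))

lemma measurable_isGeodesic (i j : ℤ) (π : List (ℤ × ℤ)) :
    Measurable fun ζ : Config => IsGeodesic configPresent configWeight i j ζ π :=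
  (measurable_isOpenPath i j π).and (Measurable.forall fun π' =>
    (measurable_isOpenPath i j π').imp (measurableSet_setOfPred.1
      (measurableSet_le (measurable_configPathWeight π') (measurable_configPathWeight π))))

lemma measurable_onGeodesic (i j : ℤ) (e : ℤ × ℤ) :
    Measurable fun ζ : Config => OnGeodesic configPresent configWeight i j ζ e :=
  Measurable.exists fun π => (measurable_isGeodesic i j π).and measurable_const

lemma measurable_champion (i j : ℤ) (e : ℤ × ℤ) :
    Measurable fun ζ : Config => Champion configPresent configWeight i j ζ e := by
  refine (measurable_onGeodesic i j e).and (Measurable.forall fun e' =>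
    (measurable_onGeodesic i j e').imp ?_)
  simp only [Prod.Lex.toLex_le_toLex]
  exact (measurableSet_setOfPred.1
    (measurableSet_lt (measurable_configWeight e') (measurable_configWeight e))).or
    ((measurableSet_setOfPred.1
      (measurableSet_eq_fun (measurable_configWeight e') (measurable_configWeight e))).and
      measurable_const)

/-- The configurations with champion `e` of weight at least `M`. -/
def heavyChampion (n : ℤ) (M : ℝ) (e : ℤ × ℤ) : Set Config :=
  {ζ | Champion configPresent configWeight 0 n ζ e ∧ M ≤ configWeight e ζ}

/-- The configurations of `heavyChampion` whose passage time lies in `[y, y + r]`. -/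
def heavyChampionIn (n : ℤ) (M y r : ℝ) (e : ℤ × ℤ) : Set Config :=
  heavyChampion n M e ∩ {ζ | ∃ π, IsGeodesic configPresent configWeight 0 n ζ π ∧
    pathWeight (fun e => configWeight e ζ) π ∈ Set.Icc y (y + r)}

lemma measurableSet_heavyChampion (n : ℤ) (M : ℝ) (e : ℤ × ℤ) :
    MeasurableSet (heavyChampion n M e) :=
  measurableSet_setOfPred.2 ((measurable_champion 0 n e).and (measurableSet_setOfPred.1
    (measurableSet_le measurable_const (measurable_configWeight e))))

lemma measurableSet_heavyChampionIn (n : ℤ) (M y r : ℝ) (e : ℤ × ℤ) :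
    MeasurableSet (heavyChampionIn n M y r e) :=
  (measurableSet_heavyChampion n M e).inter (measurableSet_setOfPred.2
    (Measurable.exists fun π => (measurable_isGeodesic 0 n π).and (measurableSet_setOfPred.1
      (measurable_configPathWeight π measurableSet_Icc))))

/-- Given all the other edges, the weights that make `e` the champion form an upper set, on which
the passage time is the weight of `e` plus a constant. -/
lemma measure_update_heavyChampionIn_le {ν : Measure ℝ} {M r : ℝ} {c : ENNReal}
    (hν : ∀ y ≥ M, ν (Set.Icc y (y + r)) ≤ c * ν (Set.Ioi (y + r))) (hr : 0 ≤ r) (n : ℤ) (y : ℝ)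
    (e : ℤ × ℤ) (ζ : Config) (b : Bool) :
    ν {x | Function.update ζ e (b, x) ∈ heavyChampionIn n M y r e} ≤
      c * ν {x | Function.update ζ e (b, x) ∈ heavyChampion n M e} := by
  classical
  have hX : ∀ x x' : ℝ, ∀ e', configPresent e' (Function.update ζ e (b, x')) =
      configPresent e' (Function.update ζ e (b, x)) := by
    intro x x' e'
    rcases eq_or_ne e' e with rfl | hne
    · simp [configPresent]
    · simp [configPresent, Function.update_of_ne hne]
  have hv : ∀ x x' : ℝ, ∀ e', e' ≠ e → configWeight e' (Function.update ζ e (b, x')) =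
      configWeight e' (Function.update ζ e (b, x)) := by
    intro x x' e' hne
    simp [configWeight, Function.update_of_ne hne]
  have hve : ∀ x : ℝ, configWeight e (Function.update ζ e (b, x)) = x := by
    intro x; simp [configWeight]
  refine measure_le_of_isUpperSet hν hr ?_ ?_ (fun x hx => hx.1) ?_
  · intro x x' hxx' hx
    rcases hxx'.eq_or_lt with rfl | hlt
    · exact hx
    refine ⟨Champion.raise (hX x x') (hv x x') (by rwa [hve, hve]) hx.1, ?_⟩
    have := hx.2
    rw [hve] at this ⊢
    exact this.trans hxx'
  · intro x hx
    have := hx.2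
    rwa [hve] at this
  · intro x hx x' hx'
    by_contra! hlt
    have hxx' : x < x' := by linarith
    obtain ⟨π, hπ, hw⟩ := hx.2
    obtain ⟨π', hπ', hw'⟩ := hx'.2
    obtain ⟨h1, h2⟩ :=
      (isGeodesic_of_raise (hX x x') (hv x x') (by rwa [hve, hve]) hx.1.1.1 π').1 hπ'
    rw [pathWeight_of_eq_off (hv x x') h1.1.1, if_pos h2, hve, hve] at hw'
    have h3 := h1.2 π hπ.1
    linarith [hw.1, hw'.2]

variable {Ω : Type*} {X : ℤ × ℤ → Ω → Bool} {v : ℤ × ℤ → Ω → ℝ}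

/-- The configuration at `ω`. -/
noncomputable def config (X : ℤ × ℤ → Ω → Bool) (v : ℤ × ℤ → Ω → ℝ) (ω : Ω) : Config :=
  fun e => edgeData X v e ω

lemma isGeodesic_config {i j : ℤ} {ω : Ω} (π : List (ℤ × ℤ)) :
    IsGeodesic X v i j ω π ↔ IsGeodesic configPresent configWeight i j (config X v ω) π :=
  isGeodesic_congr (fun e he => by simp [configPresent, config, edgeData, he])
    (fun e he => by simp [configWeight, config, edgeData, he]) π

variable [MeasurableSpace Ω] {μ : Measure Ω} {p s : ℝ} {ν : Measure ℝ}

lemma IsModel.measurable_config (h : IsModel μ p ν X v) : Measurable (config X v) :=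
  measurable_pi_iff.2 fun e => h.measurable_edgeData e

variable [IsProbabilityMeasure μ] [IsProbabilityMeasure ν]

/-- Resampling one edge: an inequality for the conditional probabilities given all the other edges
can be integrated. -/
lemma IsModel.measure_config_le (h : IsModel μ p ν X v) {e : ℤ × ℤ} (he : e.1 < e.2) {c : ENNReal}
    {A B : Set Config} (hA : MeasurableSet A) (hB : MeasurableSet B)
    (hAB : ∀ (ζ : Config) (b : Bool), ν {x | Function.update ζ e (b, x) ∈ A} ≤
      c * ν {x | Function.update ζ e (b, x) ∈ B}) :
    μ (config X v ⁻¹' A) ≤ c * μ (config X v ⁻¹' B) := by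
  classical
  set R : Ω → Config := fun ω => Function.update (config X v ω) e (false, 0) with hR
  set Φ : (Bool × ℝ) × Config → Config := fun q => Function.update q.2 e q.1 with hΦ
  have hΦm : Measurable Φ := by
    refine measurable_pi_iff.2 fun e' => ?_
    rcases eq_or_ne e' e with rfl | hne
    · simpa [hΦ] using measurable_fst
    · simp only [hΦ, Function.update_of_ne hne]
      exact (measurable_pi_apply e').comp measurable_snd
  have hRe : ∀ e' ω, R ω e' = if e' = e then (false, 0) else edgeData X v e' ω := by
    intro e' ω
    rcases eq_or_ne e' e with rfl | hne
    · simp [hR]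
    · simp [hR, hne, config]
  have hRm : Measurable R := by
    refine measurable_pi_iff.2 fun e' => ?_
    simp only [hRe]
    split_ifs
    · exact measurable_const
    · exact h.measurable_edgeData e'
  have hind : IndepFun (edgeData X v e) R μ := by
    have hle : ∀ e', MeasurableSpace.comap (edgeData X v e') inferInstance ≤
      ‹MeasurableSpace Ω› := fun e' => (h.measurable_edgeData e').comap_le
    have h1 := indep_iSup_of_disjoint hle h.iIndepFun_edgeData.iIndep
      (S := {e}) (T := {e}ᶜ) disjoint_compl_right
    refine indep_of_indep_of_le_left (indep_of_indep_of_le_right h1 ?_) ?_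
    · refine measurable_iff_comap_le.1 (@measurable_pi_iff _ _ _ (_) _ _ |>.2 fun e' => ?_)
      simp only [hRe]
      split_ifs with hee
      · exact measurable_const
      · exact Measurable.mono (comap_measurable _)
          (le_iSup₂ (f := fun e' (_ : e' ∈ ({e}ᶜ : Set (ℤ × ℤ))) =>
            MeasurableSpace.comap (edgeData X v e') inferInstance) e' hee) le_rfl
    · exact le_iSup₂ (f := fun e' (_ : e' ∈ ({e} : Set (ℤ × ℤ))) =>
            MeasurableSpace.comap (edgeData X v e') inferInstance) e rfl
  have hΦc : ∀ ω, config X v ω = Φ (edgeData X v e ω, R ω) := by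
    intro ω
    simp only [hΦ, hR, Function.update_idem]
    exact (Function.update_eq_self e (config X v ω)).symm
  have hbern : IsProbabilityMeasure (μ.map (X e)) :=
    Measure.isProbabilityMeasure_map (h.measurable_present ⟨e, he⟩).aemeasurable
  have hRprob : IsProbabilityMeasure (μ.map R) :=
    Measure.isProbabilityMeasure_map hRm.aemeasurable
  have hslice : ∀ S : Set Config, MeasurableSet S → ∀ ζ, ((μ.map (X e)).prod ν)
      ((fun z => (z, ζ)) ⁻¹' (Φ ⁻¹' S)) =
      ∫⁻ b, ν {x | Function.update ζ e (b, x) ∈ S} ∂(μ.map (X e)) := by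
    intro S hS ζ
    rw [Measure.prod_apply (measurable_prodMk_right (hΦm hS))]
    rfl
  have key : ∀ S : Set Config, MeasurableSet S → μ (config X v ⁻¹' S) =
      ∫⁻ ζ, ∫⁻ b, ν {x | Function.update ζ e (b, x) ∈ S} ∂(μ.map (X e)) ∂(μ.map R) := by
    intro S hS
    have h1 : config X v ⁻¹' S = (fun ω => (edgeData X v e ω, R ω)) ⁻¹' (Φ ⁻¹' S) := by
      ext ω; simp [hΦc ω]
    rw [h1, ← Measure.map_apply ((h.measurable_edgeData e).prodMk hRm) (hΦm hS),
      hind.map_prod_eq_prod_map_map (h.measurable_edgeData e).aemeasurable hRm.aemeasurable,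
      h.map_edgeData he, Measure.prod_apply_symm (hΦm hS)]
    exact lintegral_congr (hslice S hS)
  have hmeas : ∀ S : Set Config, MeasurableSet S → Measurable fun ζ : Config =>
      ∫⁻ b, ν {x | Function.update ζ e (b, x) ∈ S} ∂(μ.map (X e)) := by
    intro S hS
    simp only [← hslice S hS]
    exact measurable_measure_prodMk_right (hΦm hS)
  rw [key A hA, key B hB, ← lintegral_const_mul c (hmeas B hB)]
  refine lintegral_mono fun ζ => ?_
  have hb : Measurable fun b => ν {x | Function.update ζ e (b, x) ∈ B} := measurable_from_top
  rw [← lintegral_const_mul c hb]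
  exact lintegral_mono fun b => hAB ζ b

/-- The champion makes the law of the passage time as spread out as the far tail of `ν`. -/
lemma IsModel.measure_passageTime_mem_Icc_le (h : IsModel μ p ν X v) {M r : ℝ} {c : ENNReal}
    (hν : ∀ y ≥ M, ν (Set.Icc y (y + r)) ≤ c * ν (Set.Ioi (y + r))) (hr : 0 ≤ r) (n : ℤ) (y : ℝ) :
    μ {ω | passageTime X v 0 n ω ∈ Set.Icc (y : EReal) ((y + r : ℝ) : EReal)} ≤
      μ {ω | ∃ π, IsGeodesic X v 0 n ω π ∧ ∀ e ∈ π, v e ω < M} + c := by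
  have hsub : {ω | passageTime X v 0 n ω ∈ Set.Icc (y : EReal) ((y + r : ℝ) : EReal)} ⊆
      {ω | ∃ π, IsGeodesic X v 0 n ω π ∧ ∀ e ∈ π, v e ω < M} ∪
        ⋃ e ∈ edgesIn 0 n, config X v ⁻¹' heavyChampionIn n M y r e := by
    intro ω hω
    by_contra hcon
    rw [Set.mem_union, not_or] at hcon
    obtain ⟨h1, h2⟩ := hcon
    have hex : ∃ π, IsOpenPath X 0 n ω π := by
      by_contra hno
      have hω' := hω.1
      rw [passageTime_eq_bot hno] at hω'
      exact EReal.coe_ne_bot y (le_bot_iff.1 hω')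
    obtain ⟨π, hπ⟩ := exists_isGeodesic (v := v) hex
    obtain ⟨e, he, hle⟩ : ∃ e ∈ π, M ≤ v e ω := by
      by_contra! hno
      exact h1 ⟨π, hπ, hno⟩
    have hlt := hπ.1.1.edge_lt e he
    obtain ⟨e', he', hch⟩ := exists_champion (X := configPresent) (v := configWeight)
      (ω := config X v ω) ⟨π, (isGeodesic_config π).1 hπ, he⟩
    refine h2 (Set.mem_biUnion he' ⟨⟨hch, ?_⟩, π, (isGeodesic_config π).1 hπ, ?_⟩)
    · refine le_trans ?_ (hch.weight_le ⟨π, (isGeodesic_config π).1 hπ, he⟩)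
      simpa [configWeight, config, edgeData, hlt] using hle
    · have hω' := hω
      rw [Set.mem_ofPred_eq, hπ.passageTime_eq, Set.mem_Icc, EReal.coe_le_coe_iff,
        EReal.coe_le_coe_iff] at hω'
      have heq : pathWeight (fun e => configWeight e (config X v ω)) π =
          pathWeight (fun e => v e ω) π :=
        hπ.1.1.pathWeight_congr fun e he => by simp [configWeight, config, edgeData, he]
      rw [heq]
      exact hω'
  refine (measure_mono hsub).trans ((measure_union_le _ _).trans ?_)
  gcongr
  calc _ ≤ ∑ e ∈ edgesIn 0 n, μ (config X v ⁻¹' heavyChampionIn n M y r e) :=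
        measure_biUnion_finset_le _ _
    _ ≤ ∑ e ∈ edgesIn 0 n, c * μ (config X v ⁻¹' heavyChampion n M e) := by
        refine Finset.sum_le_sum fun e he => ?_
        exact h.measure_config_le (mem_edgesIn.1 he).2.1 (measurableSet_heavyChampionIn n M y r e)
          (measurableSet_heavyChampion n M e)
          (measure_update_heavyChampionIn_le hν hr n y e)
    _ = c * μ (⋃ e ∈ edgesIn 0 n, config X v ⁻¹' heavyChampion n M e) := by
        rw [← Finset.mul_sum, measure_biUnion_finset]
        · intro e _ e' _ hne
          refine Set.disjoint_left.2 fun ω hω hω' => hne (hω.1.eq hω'.1)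
        · exact fun e _ => h.measurable_config (measurableSet_heavyChampion n M e)
    _ ≤ c := mul_le_of_le_one_right' prob_le_one

/-- Intervals of length `n ^ β` carry little of the law of the passage time, uniformly in their
location. -/
theorem IsModel.eventually_measure_passageTime_le (h : IsModel μ p ν X v) (hp : 0 < p)
    (hν : HeavyTail ν s) (hs : 2 < s) (hpos : ν (Set.Iic 0) = 0) {β : ℝ} (hβ : β < 1 / (s - 1))
    {η : ENNReal} (hη : 0 < η) :
    ∀ᶠ n : ℕ in atTop, ∀ y : ℝ, μ {ω | passageTime X v 0 n ω ∈
      Set.Icc (y : EReal) ((y + (n : ℝ) ^ β : ℝ) : EReal)} ≤ η := by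
  have hη2 : 0 < η / 2 := ENNReal.half_pos hη.ne'
  obtain ⟨η', hη'0, hη'⟩ := ENNReal.lt_iff_exists_real_btwn.1 hη2
  have hη'1 : 0 < η' := ENNReal.ofReal_pos.1 hη'.1
  set α := 1 / (s - 1) with hα
  have hα0 : 0 < α := one_div_pos.2 (by linarith)
  set c := min ((α - β) / 2) (α / 2) with hc
  have hc0 : 0 < c := lt_min (by linarith) (by linarith)
  have hc1 : c ≤ (α - β) / 2 := min_le_left _ _
  have hc2 : c ≤ α / 2 := min_le_right _ _
  obtain ⟨κ, hκ, x₀, hx₀, hIcc⟩ := hν.exists_Icc_le (by linarith) hη'1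
  filter_upwards [(h.tendsto_forall_weight_lt hp hν hs hpos hc0 (by linarith)).eventually_lt_const
      hη2, (tendsto_natCast_rpow (show 0 < α - c by linarith)).eventually_ge_atTop x₀,
    tendsto_natCast_atTop_atTop.eventually
      (le_const_mul_rpow hκ (show β < α - c by linarith))] with n h1 h2 h3 y
  refine (h.measure_passageTime_mem_Icc_le (M := (n : ℝ) ^ (α - c)) (c := ENNReal.ofReal η')
    (fun y' hy' => hIcc y' (h2.trans hy') _ (h3.trans (by gcongr))) (by positivity) n y).trans ?_
  calc _ ≤ η / 2 + η / 2 := add_le_add h1.le hη'.2.le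
    _ = η := ENNReal.add_halves η

end AntiConcentration

/-! ### Variance and limit laws -/

section Variance

lemma coe_toReal_passageTime {Ω : Type*} {X : ℤ × ℤ → Ω → Bool} {v : ℤ × ℤ → Ω → ℝ} {i j : ℤ}
    {ω : Ω} (h : passageTime X v i j ω ≠ ⊥) :
    (((passageTime X v i j ω).toReal : ℝ) : EReal) = passageTime X v i j ω := by
  have hex : ∃ π, IsOpenPath X i j ω π := by
    by_contra hno
    exact h (passageTime_eq_bot hno)
  obtain ⟨π, hπ⟩ := exists_isGeodesic (v := v) hex
  rw [hπ.passageTime_eq, EReal.toReal_coe]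

/-- A law that puts at most half of its mass near its mean has a large variance. -/
lemma half_sq_le_variance {Ω : Type*} [MeasurableSpace Ω] {P : Measure Ω} [IsProbabilityMeasure P]
    {f : Ω → ℝ} (hf : MemLp f 2 P) {r : ℝ} (hr : 0 < r)
    (h : P {ω | f ω ∈ Set.Icc (P[f] - r) (P[f] + r)} ≤ 1 / 2) : r ^ 2 / 2 ≤ Var[f; P] := by
  have h1 := meas_ge_le_variance_div_sq hf hr
  have h2 : (1 : ENNReal) ≤ 1 / 2 + ENNReal.ofReal (Var[f; P] / r ^ 2) := by
    refine (measure_univ (μ := P)).symm.le.trans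
      ((measure_mono (t := {ω | f ω ∈ Set.Icc (P[f] - r) (P[f] + r)} ∪
      {ω | r ≤ |f ω - P[f]|}) fun ω _ => ?_).trans ((measure_union_le _ _).trans (add_le_add h h1)))
    rcases le_or_gt r |f ω - P[f]| with hle | hlt
    · exact Or.inr hle
    · rw [abs_lt] at hlt
      exact Or.inl ⟨by linarith [hlt.1], by linarith [hlt.2]⟩
  have h3 : (1 : ENNReal) / 2 = ENNReal.ofReal (1 / 2) := by
    rw [ENNReal.ofReal_div_of_pos two_pos]; simp
  have h0 : 0 ≤ Var[f; P] / r ^ 2 := div_nonneg (variance_nonneg _ _) (sq_nonneg _)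
  rw [h3, ← ENNReal.ofReal_add (by norm_num) h0, ENNReal.one_le_ofReal] at h2
  have h4 : 1 / 2 ≤ Var[f; P] / r ^ 2 := by linarith
  rw [le_div_iff₀ (by positivity)] at h4
  linarith

variable {Ω : Type*} [MeasurableSpace Ω] {μ : Measure Ω} {p s : ℝ} {ν : Measure ℝ}
  [IsProbabilityMeasure ν] {X : ℤ × ℤ → Ω → Bool} {v : ℤ × ℤ → Ω → ℝ}

lemma tendsto_variance_div_atTop {P : ℕ → Measure Ω} {f : ℕ → Ω → ℝ} {β : ℝ} (hβ : 1 / 2 < β)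
    (hP : ∀ᶠ n in atTop, IsProbabilityMeasure (P n)) (hf : ∀ n, MemLp (f n) 2 (P n))
    (h : ∀ᶠ n : ℕ in atTop, ∀ y : ℝ,
      P n {ω | f n ω ∈ Set.Icc y (y + (n : ℝ) ^ β)} ≤ 1 / 2) :
    Tendsto (fun n : ℕ => Var[f n; P n] / n) atTop atTop := by
  have hlim : Tendsto (fun n : ℕ => 1 / 8 * (n : ℝ) ^ (2 * β - 1)) atTop atTop :=
    (tendsto_natCast_rpow (by linarith)).const_mul_atTop (by norm_num)
  refine tendsto_atTop_mono' _ ?_ hlim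
  filter_upwards [hP, h, eventually_ge_atTop 1] with n hPn hn hn1
  have hn0 : (0 : ℝ) < n := by exact_mod_cast hn1
  have h1 := half_sq_le_variance (hf n) (r := (n : ℝ) ^ β / 2) (by positivity) (by
    refine (measure_mono fun ω hω => ?_).trans (hn ((P n)[f n] - (n : ℝ) ^ β / 2))
    exact ⟨hω.1, by linarith [hω.2]⟩)
  rw [le_div_iff₀ hn0]
  refine le_trans (le_of_eq ?_) h1
  rw [Real.rpow_sub hn0, Real.rpow_one, two_mul, Real.rpow_add hn0]
  field_simp
  norm_num

lemma IsModel.memLp_sum_abs (h : IsModel μ p ν X v) (hν : HeavyTail ν s) (hs : 2 < s)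
    (hpos : ν (Set.Iic 0) = 0) (i j : ℤ) :
    MemLp (fun ω => ∑ e ∈ edgesIn i j, |v e ω|) 2 μ := by
  have hid : MemLp (fun x : ℝ => x) 2 ν := by
    refine (memLp_two_iff_integrable_sq measurable_id.aestronglyMeasurable).2
      ⟨(measurable_id.pow_const 2).aestronglyMeasurable, ?_⟩
    simp only [id]
    rw [hasFiniteIntegral_iff_ofReal (Eventually.of_forall fun x => sq_nonneg x)]
    exact hν.lintegral_sq_lt_top hs hpos
  refine memLp_finsetSum _ fun e he => ?_
  have hlt := (mem_edgesIn.1 he).2.1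
  have hm := h.measurable_weight ⟨e, hlt⟩
  rw [← h.law_weight ⟨e, hlt⟩] at hid
  exact ((memLp_map_measure_iff measurable_id.aestronglyMeasurable hm.aemeasurable).1 hid).norm

lemma IsModel.memLp_toReal_passageTime (h : IsModel μ p ν X v) (hν : HeavyTail ν s) (hs : 2 < s)
    (hpos : ν (Set.Iic 0) = 0) (i j : ℤ) :
    MemLp (fun ω => (passageTime X v i j ω).toReal) 2 μ :=
  (h.memLp_sum_abs hν hs hpos i j).mono'
    (h.measurable_passageTime i j).ereal_toReal.aestronglyMeasurable
    (Eventually.of_forall fun _ => abs_toReal_passageTime_le i j)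

lemma IsModel.memLp_passageTimePos (h : IsModel μ p ν X v) (hν : HeavyTail ν s) (hs : 2 < s)
    (hpos : ν (Set.Iic 0) = 0) (i j : ℤ) : MemLp (passageTimePos X v i j) 2 μ := by
  have heq : passageTimePos X v i j = fun ω => max (passageTime X v i j ω).toReal 0 :=
    funext fun _ => passageTimePos_eq i j
  rw [heq]
  exact (h.memLp_toReal_passageTime hν hs hpos i j).sup (MemLp.zero')

lemma IsModel.memLp_cond_passageTime (h : IsModel μ p ν X v) (hν : HeavyTail ν s) (hs : 2 < s)
    (hpos : ν (Set.Iic 0) = 0) (i j : ℤ) (A : Set Ω) :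
    MemLp (fun ω => (passageTime X v i j ω).toReal) 2 (μ[|A]) := by
  rw [ProbabilityTheory.cond]
  -- For a null event the conditional law is the zero measure.
  by_cases hA : μ A = 0
  · rw [Measure.restrict_eq_zero.2 hA, smul_zero]
    exact memLp_measure_zero
  · exact ((h.memLp_toReal_passageTime hν hs hpos i j).restrict A).smul_measure
      (ENNReal.inv_ne_top.2 hA)

variable [IsProbabilityMeasure μ]

/-- For `s < 3` the scale `n ^ β` of anti-concentration can be taken larger than `√n`. -/
theorem IsModel.tendsto_variance_passageTimePos (h : IsModel μ p ν X v) (hp : 0 < p)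
    (hν : HeavyTail ν s) (hs : 2 < s) (hpos : ν (Set.Iic 0) = 0) (hs3 : s < 3) :
    Tendsto (fun n : ℕ => Var[passageTimePos X v 0 n; μ] / n) atTop atTop := by
  obtain ⟨β, hβ1, hβ2⟩ : ∃ β, 1 / 2 < β ∧ β < 1 / (s - 1) :=
    exists_between (one_div_lt_one_div_of_lt (by linarith) (by linarith))
  refine tendsto_variance_div_atTop hβ1 (Eventually.of_forall fun _ => inferInstance)
    (fun n => h.memLp_passageTimePos hν hs hpos 0 n) ?_
  have h4 : (0 : ENNReal) < 1 / 4 := by simp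
  filter_upwards [h.eventually_measure_passageTime_le hp hν hs hpos hβ2 h4,
    (h.tendsto_not_exists_path hp hν).eventually_le_const h4] with n h1 h2 y
  refine (measure_mono (t := {ω | passageTime X v 0 n ω ∈
      Set.Icc (y : EReal) ((y + (n : ℝ) ^ β : ℝ) : EReal)} ∪ {ω | ¬ ∃ π, IsOpenPath X 0 n ω π ∧
      0 ≤ pathWeight (fun e => v e ω) π}) fun ω hω => ?_).trans
      ((measure_union_le _ _).trans ((add_le_add (h1 y) h2).trans ?_))
  · by_cases hex : ∃ π, IsOpenPath X 0 n ω π ∧ 0 ≤ pathWeight (fun e => v e ω) π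
    · obtain ⟨π, hπ, hw⟩ := hex
      obtain ⟨π', hπ'⟩ := exists_isGeodesic (v := v) ⟨π, hπ⟩
      refine Or.inl ?_
      have h3 := hω
      rw [Set.mem_ofPred_eq, passageTimePos_eq, hπ'.passageTime_eq, EReal.toReal_coe,
        max_eq_left (hw.trans (hπ'.2 π hπ))] at h3
      rw [Set.mem_ofPred_eq, hπ'.passageTime_eq]
      exact ⟨EReal.coe_le_coe h3.1, EReal.coe_le_coe h3.2⟩
    · exact Or.inr hex
  · rw [← ENNReal.ofReal_ofNat 2, ← ENNReal.ofReal_ofNat 4, ← ENNReal.ofReal_one,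
      ← ENNReal.ofReal_div_of_pos (by norm_num), ← ENNReal.ofReal_div_of_pos (by norm_num),
      ← ENNReal.ofReal_add (by norm_num) (by norm_num)]
    exact ENNReal.ofReal_le_ofReal (by norm_num)

theorem IsModel.tendsto_variance_cond_passageTime (h : IsModel μ p ν X v) (hp : 0 < p)
    (hν : HeavyTail ν s) (hs : 2 < s) (hpos : ν (Set.Iic 0) = 0) (hs3 : s < 3) :
    Tendsto (fun n : ℕ => Var[fun ω => (passageTime X v 0 n ω).toReal;
      μ[|{ω | passageTime X v 0 n ω ≠ ⊥}]] / n) atTop atTop := by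
  obtain ⟨β, hβ1, hβ2⟩ : ∃ β, 1 / 2 < β ∧ β < 1 / (s - 1) :=
    exists_between (one_div_lt_one_div_of_lt (by linarith) (by linarith))
  have h4 : (0 : ENNReal) < 1 / 4 := by simp
  have h2' : (0 : ENNReal) < 1 / 2 := by simp
  have hmeas : ∀ n : ℕ, MeasurableSet {ω | passageTime X v 0 n ω ≠ ⊥} := fun n =>
    (h.measurable_passageTime 0 n (measurableSet_singleton ⊥)).compl
  have hhalf : ∀ᶠ n : ℕ in atTop, 1 / 2 ≤ μ {ω | passageTime X v 0 n ω ≠ ⊥} := by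
    filter_upwards [(h.tendsto_not_exists_path hp hν).eventually_le_const h2'] with n hn
    have h1 : μ {ω | passageTime X v 0 n ω ≠ ⊥}ᶜ ≤ 1 / 2 := by
      refine (measure_mono fun ω hω hex => ?_).trans hn
      obtain ⟨π, hπ, -⟩ := hex
      obtain ⟨π', hπ'⟩ := exists_isGeodesic (v := v) ⟨π, hπ⟩
      exact hω (by rw [Set.mem_ofPred_eq, hπ'.passageTime_eq]; exact EReal.coe_ne_bot _)
    have h3 := prob_add_prob_compl (μ := μ) (hmeas n)
    by_contra! hlt
    have : μ {ω | passageTime X v 0 n ω ≠ ⊥} + μ {ω | passageTime X v 0 n ω ≠ ⊥}ᶜ <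
        1 / 2 + 1 / 2 := ENNReal.add_lt_add_of_lt_of_le (measure_ne_top _ _) hlt h1
    rw [h3, ENNReal.add_halves] at this
    exact lt_irrefl _ this
  refine tendsto_variance_div_atTop hβ1 ?_ (fun n => h.memLp_cond_passageTime hν hs hpos 0 n _) ?_
  · filter_upwards [hhalf] with n hn
    exact cond_isProbabilityMeasure (h2'.trans_le hn).ne'
  · filter_upwards [hhalf, h.eventually_measure_passageTime_le hp hν hs hpos hβ2 h4] with n hn h1 y
    rw [cond_apply (hmeas n)]
    have h3 : (μ {ω | passageTime X v 0 n ω ≠ ⊥})⁻¹ ≤ 2 := by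
      rw [← inv_inv (2 : ENNReal), ENNReal.inv_le_inv, ← one_div]
      exact hn
    calc _ ≤ 2 * (1 / 4 : ENNReal) := by
          refine mul_le_mul' h3 ((measure_mono ?_).trans (h1 y))
          rintro ω ⟨hω1, hω2⟩
          rw [Set.mem_ofPred_eq, ← coe_toReal_passageTime hω1]
          exact ⟨EReal.coe_le_coe hω2.1, EReal.coe_le_coe hω2.2⟩
      _ ≤ 1 / 2 := by
          rw [← ENNReal.ofReal_ofNat 2, ← ENNReal.ofReal_ofNat 4, ← ENNReal.ofReal_one,
            ← ENNReal.ofReal_div_of_pos (by norm_num), ← ENNReal.ofReal_mul (by norm_num),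
            ← ENNReal.ofReal_div_of_pos (by norm_num)]
          exact ENNReal.ofReal_le_ofReal (by norm_num)

/-- A limit law would put most of its mass on a bounded interval, and so would the passage time on
an interval of length of order `√n`, contrary to its anti-concentration. -/
theorem IsModel.not_tendstoInDistribution (h : IsModel μ p ν X v) (hp : 0 < p)
    (hν : HeavyTail ν s) (hs : 2 < s) (hpos : ν (Set.Iic 0) = 0) (hs3 : s < 3) {t : ℝ} (ht : 0 < t)
    (a : ℕ → ℝ) {κ : ℝ} (hκ : 0 < κ) (ρ : Measure ℝ) [IsProbabilityMeasure ρ] :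
    ¬ TendstoInDistribution
      (fun (n : ℕ) ω => (passageTime X v 0 ⌊(n : ℝ) * t⌋ ω - ((a n : ℝ) : EReal)) /
        ((κ * Real.sqrt n : ℝ) : EReal))
      atTop (fun x : ℝ => (x : EReal)) (fun _ => μ) ρ := by
  intro hlim
  obtain ⟨β, hβ1, hβ2⟩ : ∃ β, 1 / 2 < β ∧ β < 1 / (s - 1) :=
    exists_between (one_div_lt_one_div_of_lt (by linarith) (by linarith))
  have h2' : (0 : ENNReal) < 1 / 2 := by simp
  obtain ⟨K, hK0, hK⟩ : ∃ K : ℝ, 0 < K ∧ 1 / 2 < ρ (Set.Ioo (-K) K) := by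
    have hmono : Monotone fun k : ℕ => Set.Ioo (-(k : ℝ)) k := fun k l hkl =>
      Set.Ioo_subset_Ioo (neg_le_neg (by exact_mod_cast hkl)) (by exact_mod_cast hkl)
    have h1 := tendsto_measure_iUnion_atTop (μ := ρ) hmono
    have h2 : ⋃ k : ℕ, Set.Ioo (-(k : ℝ)) k = Set.univ := by
      refine Set.eq_univ_of_forall fun x => ?_
      obtain ⟨k, hk⟩ := exists_nat_gt |x|
      exact Set.mem_iUnion.2 ⟨k, abs_lt.1 hk⟩
    rw [h2, measure_univ] at h1
    obtain ⟨k, hk1, hk2⟩ := ((h1.eventually_const_lt ENNReal.one_half_lt_one).and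
      (eventually_ge_atTop 1)).exists
    exact ⟨k, by exact_mod_cast hk2, by simpa using hk1⟩
  set G : Set EReal := Set.Ioo ((-K : ℝ) : EReal) ((K : ℝ) : EReal) with hG
  -- The portmanteau theorem is stated for metric spaces.
  let _ : MetricSpace EReal := TopologicalSpace.metrizableSpaceMetric EReal
  have hport := ProbabilityMeasure.le_liminf_measure_open_of_tendsto hlim.tendsto
    (isOpen_Ioo : IsOpen G)
  simp only [ProbabilityMeasure.coe_mk] at hport
  have hρG : ρ.map (fun x : ℝ => (x : EReal)) G = ρ (Set.Ioo (-K) K) := by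
    rw [Measure.map_apply measurable_coe_real_ereal measurableSet_Ioo]
    congr 1
    ext x
    simp only [Set.mem_preimage, Set.mem_Ioo, EReal.coe_lt_coe_iff]
  rw [hρG] at hport
  have hm : Tendsto (fun n : ℕ => ⌊(n : ℝ) * t⌋₊) atTop atTop :=
    tendsto_nat_floor_atTop.comp (tendsto_natCast_atTop_atTop.atTop_mul_const ht)
  have hsmall : ∀ᶠ n : ℕ in atTop, μ.map (fun ω =>
      (passageTime X v 0 ⌊(n : ℝ) * t⌋ ω - ((a n : ℝ) : EReal)) /
        ((κ * Real.sqrt n : ℝ) : EReal)) G ≤ 1 / 2 := by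
    filter_upwards [hm.eventually (h.eventually_measure_passageTime_le hp hν hs hpos hβ2 h2'),
      (tendsto_natCast_atTop_atTop.comp hm).eventually
        (const_mul_rpow_le (C := 2 * K * κ * Real.sqrt (2 / t)) hβ1),
      hm.eventually (eventually_ge_atTop 1), eventually_ge_atTop 1] with n h1 h2 h3 hn
    have hn0 : (0 : ℝ) < n := by exact_mod_cast hn
    have hκn : 0 < κ * Real.sqrt n := mul_pos hκ (Real.sqrt_pos.2 hn0)
    rw [Measure.map_apply_of_aemeasurable (hlim.forall_aemeasurable n) measurableSet_Ioo]
    refine (measure_mono fun ω hω => ?_).trans (h1 (a n - K * (κ * Real.sqrt n)))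
    rw [Int.natCast_floor_eq_floor (by positivity)]
    rw [Set.mem_preimage] at hω
    set w := passageTime X v 0 ⌊(n : ℝ) * t⌋ ω with hw
    have hbot : w ≠ ⊥ := by
      intro hbot
      rw [hbot, EReal.bot_sub, EReal.bot_div_of_pos_ne_top (by exact_mod_cast hκn)
        (EReal.coe_ne_top _)] at hω
      exact not_lt_bot hω.1
    have hcoe := coe_toReal_passageTime hbot
    rw [← hw] at hcoe
    rw [← hcoe, ← EReal.coe_sub, ← EReal.coe_div] at hω
    have hω1 := EReal.coe_lt_coe_iff.1 hω.1
    have hω2 := EReal.coe_lt_coe_iff.1 hω.2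
    rw [lt_div_iff₀ hκn] at hω1
    rw [div_lt_iff₀ hκn] at hω2
    -- The scale `√n` is comparable to `√m` for `m = ⌊n t⌋`, and thus smaller than `m ^ β`.
    have hwidth : 2 * K * (κ * Real.sqrt n) ≤ (⌊(n : ℝ) * t⌋₊ : ℝ) ^ β := by
      refine le_trans ?_ h2
      have hle : Real.sqrt n ≤ Real.sqrt (2 / t) * (⌊(n : ℝ) * t⌋₊ : ℝ) ^ (1 / 2 : ℝ) := by
        rw [← Real.sqrt_eq_rpow, ← Real.sqrt_mul (by positivity)]
        refine Real.sqrt_le_sqrt ?_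
        have h5 := Nat.lt_floor_add_one ((n : ℝ) * t)
        have h6 : (1 : ℝ) ≤ (⌊(n : ℝ) * t⌋₊ : ℝ) := by exact_mod_cast h3
        rw [div_mul_eq_mul_div, le_div_iff₀ ht]
        linarith
      calc 2 * K * (κ * Real.sqrt n)
          ≤ 2 * K * (κ * (Real.sqrt (2 / t) * (⌊(n : ℝ) * t⌋₊ : ℝ) ^ (1 / 2 : ℝ))) := by gcongr
        _ = _ := by simp only [Function.comp_apply]; ring
    rw [Set.mem_ofPred_eq, ← hw, ← hcoe]
    refine ⟨EReal.coe_le_coe (by linarith), EReal.coe_le_coe (by linarith)⟩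
  have hle : liminf (fun n : ℕ => μ.map (fun ω =>
      (passageTime X v 0 ⌊(n : ℝ) * t⌋ ω - ((a n : ℝ) : EReal)) /
        ((κ * Real.sqrt n : ℝ) : EReal)) G) atTop ≤ 1 / 2 :=
    liminf_le_of_le (by isBoundedDefault) fun b hb => by
      obtain ⟨n, h1, h2⟩ := (hb.and hsmall).exists
      exact h1.trans h2
  exact absurd (hK.trans_le (hport.trans hle)) (lt_irrefl _)

end Variance

end LongRangeLPP

open LongRangeLPP in
theorem theorem3 {Ω : Type*} [MeasurableSpace Ω] (μ : Measure Ω) [IsProbabilityMeasure μ]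
    (p : ℝ) (hp0 : 0 < p) (hp1 : p ≤ 1)
    (ν : Measure ℝ) [IsProbabilityMeasure ν] (hpos : ν (Set.Iic 0) = 0)
    (X : ℤ × ℤ → Ω → Bool) (v : ℤ × ℤ → Ω → ℝ) (hmodel : IsModel μ p ν X v)
    (s : ℝ) (hs : 2 < s)
    (htail : ∀ t : ℝ, 0 < t →
      Tendsto (fun x : ℝ => (1 - cdf ν (t * x)) / (1 - cdf ν x)) atTop (𝓝 (t ^ (-s)))) :
    -- longest edge and heaviest edge, for every way of selecting the geodesics
    (∀ γ : ℕ → Ω → List (ℤ × ℤ),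
      (∀ n : ℕ, ∀ᵐ ω ∂μ, (∃ π, IsOpenPath X 0 n ω π) → IsGeodesic X v 0 n ω (γ n ω)) →
        TendstoInMeasure μ
          (fun (n : ℕ) ω => Real.log (longestEdge (γ n ω)) / Real.log n) atTop
          (fun _ => 1 / (s - 1)) ∧
        TendstoInMeasure μ
          (fun (n : ℕ) ω => Real.log (heaviestEdge v ω (γ n ω)) / Real.log n) atTop
          (fun _ => 1 / (s - 1))) ∧
    -- fluctuations of the passage time
    (∀ β : ℝ, β < 1 / (s - 1) → ∀ y : ℕ → ℝ,
      Tendsto (fun n : ℕ => μ {ω | passageTime X v 0 n ω ∈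
        Set.Icc ((y n : ℝ) : EReal) ((y n + (n : ℝ) ^ β : ℝ) : EReal)}) atTop (𝓝 0)) ∧
    (s < 3 →
      -- the variance, of the positive part
      ((∀ n : ℕ, MemLp (passageTimePos X v 0 n) 2 μ) ∧
        Tendsto (fun n : ℕ => Var[passageTimePos X v 0 n; μ] / n) atTop atTop) ∧
      -- the variance, conditionally on the existence of a path
      ((∀ n : ℕ, MemLp (fun ω => (passageTime X v 0 n ω).toReal) 2
          (μ[|{ω | passageTime X v 0 n ω ≠ ⊥}])) ∧
        Tendsto (fun n : ℕ =>
          Var[fun ω => (passageTime X v 0 n ω).toReal;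
            μ[|{ω | passageTime X v 0 n ω ≠ ⊥}]] / n) atTop atTop) ∧
      -- no central limit theorem, nor any other limit law on the scale of the square root
      (∀ t : ℝ, 0 < t → ∀ (a : ℕ → ℝ) (κ : ℝ), 0 < κ →
        ∀ (ρ : Measure ℝ) [IsProbabilityMeasure ρ],
          ¬ TendstoInDistribution
            (fun (n : ℕ) ω => (passageTime X v 0 ⌊(n : ℝ) * t⌋ ω - ((a n : ℝ) : EReal)) /
              ((κ * Real.sqrt n : ℝ) : EReal))
            atTop (fun x : ℝ => (x : EReal)) (fun _ => μ) ρ)) := by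
  have hν : HeavyTail ν s := by
    intro t ht
    have := htail t ht
    simp only [one_sub_cdf] at this
    exact this
  refine ⟨fun γ hγ => ⟨hmodel.tendstoInMeasure_longestEdge hp0 hν hs hpos hγ,
    hmodel.tendstoInMeasure_heaviestEdge hp0 hν hs hpos hγ⟩, fun β hβ y => ?_, fun hs3 => ?_⟩
  · rw [ENNReal.tendsto_nhds_zero]
    intro η hη
    filter_upwards [hmodel.eventually_measure_passageTime_le hp0 hν hs hpos hβ hη] with n hn
    exact hn (y n)
  · exact ⟨⟨fun n => hmodel.memLp_passageTimePos hν hs hpos 0 n,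
      hmodel.tendsto_variance_passageTimePos hp0 hν hs hpos hs3⟩,
      ⟨fun n => hmodel.memLp_cond_passageTime hν hs hpos 0 n _,
        hmodel.tendsto_variance_cond_passageTime hp0 hν hs hpos hs3⟩,
      fun t ht a κ hκ ρ _ => hmodel.not_tendstoInDistribution hp0 hν hs hpos hs3 ht a hκ ρ⟩
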